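/- **Setting.** Let $r$ and $n=q_1r+r_1$ be positive integers with $q_1\ge 1$ and $0<r_1<r$. Let $\mathcal A$ be the algebra of germs at the origin of holomorphic functions on $\mathbb C^n\times\mathbb C^r$, with coordinates $a_0,\dots,a_{n-1},b_0,\dots,b_{r-1}$, and put $m=n+r$. For an ideal $J\subseteq\mathcal A$ let $\Delta_kJ$ be the ideal generated by $J$ and all $k\times k$ minors of Jacobian matrices (with respect to the $m$ coordinates) of elements of $J$ (the minor of order $0$ is $1$), and let $\Delta^iJ=\Delta_{m-i+1}J$. The ideal $\Delta^iJ$ is called the critical extension of $J$ if $\Delta_{m-i+1}J\ne\mathcal A$ and $\Delta_{m-i}J=\mathcal A$. Let $I(\mu_{n,r})\subseteq\mathcal A$ be the ideal generated by the coefficients $c_0,\dots,c_{n+r-1}$ of $$(x^n+a_{n-1}x^{n-1}+\dots+a_0)(x^r+b_{r-1}x^{r-1}+\dots+b_0)=x^{n+r}+c_{n+r-1}x^{n+r-1}+\dots+c_0 .$$ Define polynomials $d_{n-1},\dots,d_0$ by $d_{n-j}=a_{n-j}-b_{r-j}-\sum_{i+k=j,\ i,k\ge1}d_{n-i}b_{r-k}$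 for $1\le j\le n$, where $b_l$ is read as $0$ for $l<0$. Let $L_n$ be the $n\times n$ lower shift matrix (ones on the subdiagonal, zeros elsewhere), and let $$B=I_n+b_{r-1}L_n+\dots+b_0L_n^r,\qquad \widehat D=I_n+d_{n-1}L_n+\dots+d_1L_n^{n-1}.$$ For $1\le k<n$ let $\beta_k$ be the entry of $(B^{-q_1}\widehat D)^{-1}$ in row $n-k+1$ of its first column. Define - $\psi_i=d_i$ for $0\le i<r$; - $\psi_{sr+i}=\dfrac{\partial^s d_{r-1}}{\partial b_0^{\,s-1}\,\partial b_{r-1-i}}$ for $1\le s\le q_1-1$ and $0\le i<r$; - $\psi_{q_1r+i}=\beta_{(q_1-1)r+r_1+i}$ for $0\le i<r_1$. **Theorem 3.10.** The first $q_1+1$ successive critical extensions of $I(\mu_{n,r})$ are obtained by applying $\Delta^r$ $q_1$ times and then $\Delta^{r_1}$: for $0\le s<q_1$ the ideal $\Delta^r\big((\Delta^r)^sI(\mu_{n,r})\big)$ is the critical extension of $(\Delta^r)^sI(\mu_{n,r})$, and $\Delta^{r_1}\big((\Delta^r)^{q_1}I(\mu_{n,r})\big)$ is the critical extension of $(\Delta^r)^{q_1}I(\mu_{n,r})$.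 Moreover $$(B^{-q_1}\widehat D)^{-1}=I_n+\beta_{n-1}L_n+\dots+\beta_1L_n^{n-1},$$ and the $(q_1+1)$-th critical extension is $$\Delta^{r_1}\big((\Delta^r)^{q_1}I(\mu_{n,r})\big)=I(\mu_{n,r})+(\psi_0,\dots,\psi_{q_1r-1},\psi_{q_1r},\dots,\psi_{q_1r+r_1-1}).$$ -/

import Mathlib

open Filter Topology

noncomputable section

/-! ### Germs of holomorphic functions and Jacobian extensions -/

/-- The algebra of germs at the origin of holomorphic functions on `ℂ^σ`, as a subring of the
ring of all germs at `0` of functions `ℂ^σ → ℂ`. -/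
def HolGerm (σ : Type) [Fintype σ] : Subring (Germ (𝓝 (0 : σ → ℂ)) ℂ) where
  carrier := {φ | ∃ f : (σ → ℂ) → ℂ, AnalyticAt ℂ f 0 ∧ (f : Germ (𝓝 (0 : σ → ℂ)) ℂ) = φ}
  mul_mem' := by
    rintro _ _ ⟨f, hf, rfl⟩ ⟨g, hg, rfl⟩
    exact ⟨f * g, hf.mul hg, rfl⟩
  one_mem' := ⟨fun _ => 1, analyticAt_const, rfl⟩
  add_mem' := by
    rintro _ _ ⟨f, hf, rfl⟩ ⟨g, hg, rfl⟩
    exact ⟨f + g, hf.add hg, rfl⟩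
  zero_mem' := ⟨fun _ => 0, analyticAt_const, rfl⟩
  neg_mem' := by
    rintro _ ⟨f, hf, rfl⟩
    exact ⟨-f, hf.neg, rfl⟩

/-- The partial derivative `∂φ/∂x_j` of a holomorphic germ `φ`. -/
def HolGerm.partialDeriv {σ : Type} [Fintype σ] [DecidableEq σ] (j : σ) (φ : HolGerm σ) :
    HolGerm σ :=
  ⟨Germ.map' (fun f x => fderiv ℂ f x (Pi.single j 1))
      (fun _ _ h => (h.fderiv (𝕜 := ℂ)).mono fun x hx => by simp only [hx]) φ.1, by
    obtain ⟨_, f, hf, rfl⟩ := φ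
    exact ⟨fun x => fderiv ℂ f x (Pi.single j 1),
      (ContinuousLinearMap.apply ℂ ℂ (Pi.single j 1 : σ → ℂ)).analyticAt _ |>.comp hf.fderiv,
      rfl⟩⟩

/-- The germ at the origin of a polynomial function. -/
def polyGerm {σ : Type} [Fintype σ] (p : MvPolynomial σ ℂ) : HolGerm σ :=
  ⟨((fun x : σ → ℂ => MvPolynomial.eval x p : (σ → ℂ) → ℂ) : Germ (𝓝 (0 : σ → ℂ)) ℂ),
    _, AnalyticOnNhd.eval_mvPolynomial p 0 (Set.mem_univ 0), rfl⟩

/-- The Jacobian extension `Δ_k J`: the ideal spanned by `J` and all minors of order `k` of the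
Jacobian matrix `(∂f_i/∂x_j)` formed from the partial derivatives of the functions `f ∈ J`.
(A choice of rows or columns with repetition contributes only the determinant `0`.) -/
def jacobianExt {σ : Type} [Fintype σ] [DecidableEq σ] (k : ℕ) (J : Ideal (HolGerm σ)) :
    Ideal (HolGerm σ) :=
  J ⊔ Ideal.span {φ | ∃ (f : Fin k → HolGerm σ) (c : Fin k → σ), (∀ i, f i ∈ J) ∧
    φ = Matrix.det (Matrix.of fun i j => HolGerm.partialDeriv (c j) (f i))}

/-- Upper indexing: `Δ^i J = Δ_{m-i+1} J`, where `m` is the number of variables. -/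
def upperJacobianExt {σ : Type} [Fintype σ] [DecidableEq σ] (i : ℕ) (J : Ideal (HolGerm σ)) :
    Ideal (HolGerm σ) :=
  jacobianExt (Fintype.card σ + 1 - i) J

/-- `Δ^i J` is a critical extension of `J`: with `k = m - i + 1` (and `0 ≤ i ≤ m`) one has
`Δ_k J ≠ 𝒜` and `Δ_{k-1} J = 𝒜`. -/
def IsCriticalUpper {σ : Type} [Fintype σ] [DecidableEq σ] (i : ℕ) (J : Ideal (HolGerm σ)) :
    Prop :=
  i ≤ Fintype.card σ ∧ jacobianExt (Fintype.card σ + 1 - i) J ≠ ⊤ ∧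
    jacobianExt (Fintype.card σ - i) J = ⊤

/-! ### The polynomial multiplication map -/

/-- The coordinate ring of `ℂ^n × ℂ^r`, with coordinates `a_0, …, a_{n-1}` (left summand) and
`b_0, …, b_{r-1}` (right summand). -/
abbrev CoeffRing (n r : ℕ) : Type := MvPolynomial (Fin n ⊕ Fin r) ℂ

/-- The coordinate `a_i`, for `i < n`. -/
def aVar (n r i : ℕ) : CoeffRing n r :=
  if h : i < n then MvPolynomial.X (Sum.inl ⟨i, h⟩) else 0

/-- The coordinate `b_j`, for `j < r`. -/
def bVar (n r j : ℕ) : CoeffRing n r :=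
  if h : j < r then MvPolynomial.X (Sum.inr ⟨j, h⟩) else 0

/-- `f(x) = x^n + a_{n-1} x^{n-1} + ⋯ + a_0`. -/
def genericF (n r : ℕ) : Polynomial (CoeffRing n r) :=
  Polynomial.X ^ n + ∑ i ∈ Finset.range n, Polynomial.C (aVar n r i) * Polynomial.X ^ i

/-- `g(x) = x^r + b_{r-1} x^{r-1} + ⋯ + b_0`. -/
def genericG (n r : ℕ) : Polynomial (CoeffRing n r) :=
  Polynomial.X ^ r + ∑ j ∈ Finset.range r, Polynomial.C (bVar n r j) * Polynomial.X ^ j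

/-- `c_j`, the coefficient of `x^j` in `h(x) = f(x) g(x)`. -/
def cPoly (n r j : ℕ) : CoeffRing n r := (genericF n r * genericG n r).coeff j

/-- The ideal `I(μ_{n,r})` of germs generated by `c_0, …, c_{n+r-1}`. -/
def muIdeal (n r : ℕ) : Ideal (HolGerm (Fin n ⊕ Fin r)) :=
  Ideal.span {φ | ∃ j, j < n + r ∧ φ = polyGerm (cPoly n r j)}

/-! ### Toeplitz matrices -/

/-- The lower shift matrix `L_N`. -/
def lowerShift (R : Type) [CommRing R] (N : ℕ) : Matrix (Fin N) (Fin N) R :=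
  Matrix.of fun i j => if (i : ℕ) = j + 1 then 1 else 0

/-- The lower Toeplitz matrix `I_N + v_{m-1} L_N + v_{m-2} L_N^2 + ⋯ + v_0 L_N^m`. -/
def lowerToeplitz {R : Type} [CommRing R] (N m : ℕ) (v : ℕ → R) : Matrix (Fin N) (Fin N) R :=
  1 + ∑ k ∈ Finset.Icc 1 m, v (m - k) • lowerShift R N ^ k

/-- The coefficient of `L_N^k` in a lower Toeplitz matrix: its entry in row `k` of the first
column (counting from `0`). -/
def toeplitzCoeff {R : Type} [CommRing R] {N : ℕ} (M : Matrix (Fin N) (Fin N) R) (k : ℕ) : R :=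
  if h : k < N then M ⟨k, h⟩ ⟨0, by omega⟩ else 0

/-! ### The polynomials `d`, `β` and `ψ` -/

/-- `dTop n r j` is `d_{n-j}`, for `1 ≤ j ≤ n`, given by the recursion
`d_{n-j} = a_{n-j} - b_{r-j} - ∑_{i+k=j} d_{n-i} b_{r-k}` (`i, k ≥ 1`), where `b_{r-k}` is
omitted if `k > r`. -/
def dTop (n r j : ℕ) : CoeffRing n r :=
  aVar n r (n - j) - (if j ≤ r then bVar n r (r - j) else 0)
    - ∑ i ∈ (Finset.Ioo 0 j).attach,
        dTop n r i.1 * (if j - i.1 ≤ r then bVar n r (r - (j - i.1)) else 0)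
termination_by j
decreasing_by exact (Finset.mem_Ioo.mp i.2).2

/-- `d_k`, for `0 ≤ k < n`. -/
def dPoly (n r k : ℕ) : CoeffRing n r := dTop n r (n - k)

/-- `B = I_n + b_{r-1} L_n + ⋯ + b_0 L_n^r`. -/
def matB (n r : ℕ) : Matrix (Fin n) (Fin n) (CoeffRing n r) := lowerToeplitz n r (bVar n r)

/-- `D̂ = I_n + d_{n-1} L_n + ⋯ + d_1 L_n^{n-1}` (the summand with `L_n^n = 0` is harmless). -/
def matDhat (n r : ℕ) : Matrix (Fin n) (Fin n) (CoeffRing n r) := lowerToeplitz n n (dPoly n r)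

/-- The Toeplitz matrix `B^{-q} D̂`. -/
def matBD (n r q : ℕ) : Matrix (Fin n) (Fin n) (CoeffRing n r) := (matB n r)⁻¹ ^ q * matDhat n r

/-- `β_k`, for `1 ≤ k < n`: the coefficient of `L_n^{n-k}` in `(B^{-q} D̂)⁻¹`. -/
def betaPoly (n r q k : ℕ) : CoeffRing n r := toeplitzCoeff (matBD n r q)⁻¹ (n - k)

/-- The partial derivative `∂p/∂b_j`, for `j < r`. -/
def derivB (n r j : ℕ) (p : CoeffRing n r) : CoeffRing n r :=
  if h : j < r then MvPolynomial.pderiv (Sum.inr ⟨j, h⟩) p else 0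

/-- The polynomials `ψ_k`, where `n = q r + r₁`:
* `ψ_i = d_i` for `0 ≤ i < r`;
* `ψ_{sr+i} = ∂^s d_{r-1} / ∂b_0^{s-1} ∂b_{r-1-i}` for `1 ≤ s ≤ q - 1`, `0 ≤ i < r`;
* `ψ_{qr+i} = β_{(q-1)r+r₁+i}` for `0 ≤ i < r₁`. -/
def psiPoly (n r q r₁ k : ℕ) : CoeffRing n r :=
  if k < r then dPoly n r k
  else if k < q * r then
    (derivB n r 0)^[k / r - 1] (derivB n r (r - 1 - k % r) (dPoly n r (r - 1)))
  else betaPoly n r q ((q - 1) * r + r₁ + (k - q * r))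

/-- A lower Toeplitz matrix with unit diagonal is invertible, so that the matrix inverses above
are genuine ones. -/
theorem isUnit_det_lowerToeplitz {R : Type} [CommRing R] (N m : ℕ) (v : ℕ → R) :
    IsUnit (lowerToeplitz N m v).det := by
  have hL : ∀ k : ℕ, ∀ i j : Fin N, (i : ℕ) < j + k → (lowerShift R N ^ k) i j = 0 := by
    intro k
    induction k with
    | zero =>
      intro i j h
      rw [pow_zero, Matrix.one_apply_ne]
      rintro rfl
      omega
    | succ k ih =>
      intro i j h
      rw [pow_succ, Matrix.mul_apply]
      refine Finset.sum_eq_zero fun l _ => ?_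
      by_cases hl : (l : ℕ) = j + 1
      · rw [ih i l (by omega), zero_mul]
      · simp [lowerShift, hl]
  have hS : ∀ i j : Fin N, (i : ℕ) ≤ j →
      (∑ k ∈ Finset.Icc 1 m, v (m - k) • lowerShift R N ^ k) i j = 0 := by
    intro i j h
    rw [Matrix.sum_apply]
    refine Finset.sum_eq_zero fun k hk => ?_
    have := (Finset.mem_Icc.mp hk).1
    rw [Matrix.smul_apply, hL k i j (by omega), smul_zero]
  rw [Matrix.det_of_isLowerTriangular]
  · have : ∀ i : Fin N, lowerToeplitz N m v i i = 1 := fun i => by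
      rw [lowerToeplitz, Matrix.add_apply, hS i i le_rfl, Matrix.one_apply_eq, add_zero]
    simp [this]
  · intro i j hij
    have hij' : i < j := hij
    rw [lowerToeplitz, Matrix.add_apply, hS i j (le_of_lt hij'),
      Matrix.one_apply_ne hij'.ne, add_zero]

end

noncomputable section

open PowerSeries

/-! ### Power series of bounded degree -/

/-! Reversing the two polynomials gives series F and G with constant term 1, and the c_j become the
coefficients of FG in positive degree. The d's are the coefficients of F/G. Since ∂/∂b_j sends F/G^k
to -k X^(r-j) F/G^(k+1), the first q₁r of the ψ's are, up to nonzero constants, the numbers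
`quotCoeff`. Lower Toeplitz matrices are images of series under X ↦ L_n (`toeplitzHom`), so the β's
are coefficients of G^(q₁+1)/F.

The s-th extension is `stageIdeal` at s. Modulo it, FG = 1 and F/G^s has degree at most n-sr
(`CoordPair.degLE_quot`). Directions preserving these relations are given by the variation Y of
F/G^s, of degree at most n-sr, and the variation Z of G, of degree at most r; along them FG varies
by G^(s+1) Y + (s+1) F Z. Multiplying by a unit series A only changes the equations invertibly.

While (s+1)r ≤ n, take A = G^-(s+1). Then Y contributes an identity block of size n-sr. Together
with a unitriangular block of size sr, from the quotient coefficients against the ∂/∂a_k, this is a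
unit minor of order n. The minors of order n+1 record what (s+1) F/G^(s+1) Z contributes above
degree n-sr, namely the next r quotient coefficients. At s = q₁ the remaining degree is r₁ < r, and
A = 1/F makes Z supply the identity block, up to the factor s+1; the new relations are then the
coefficients of degree r-i, i < r₁, of G^(s+1)/F.

`CoordPair.exists_mem_minorExt` produces these minors, and `CoordPair.minorExt_stageIdeal_le` shows
that there are no others. The ideals are proper because all generators vanish at the origin, where F
= G = 1. -/

/-- All coefficients of `A` beyond the `N`-th vanish. -/
def DegLE {R : Type*} [CommRing R] (N : ℕ) (A : R⟦X⟧) : Prop := ∀ l, N < l → coeff l A = 0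

section DegLE
variable {R S : Type*} [CommRing R] [CommRing S]

theorem DegLE.mono {N M : ℕ} {A : R⟦X⟧} (h : DegLE N A) (hNM : N ≤ M) : DegLE M A :=
  fun l hl => h l (by omega)

theorem DegLE.add {N : ℕ} {A B : R⟦X⟧} (hA : DegLE N A) (hB : DegLE N B) : DegLE N (A + B) :=
  fun l hl => by rw [map_add, hA l hl, hB l hl, add_zero]

theorem DegLE.neg {N : ℕ} {A : R⟦X⟧} (hA : DegLE N A) : DegLE N (-A) :=
  fun l hl => by rw [map_neg, hA l hl, neg_zero]

theorem DegLE.mul {N M : ℕ} {A B : R⟦X⟧} (hA : DegLE N A) (hB : DegLE M B) :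
    DegLE (N + M) (A * B) := by
  intro l hl
  rw [coeff_mul]
  refine Finset.sum_eq_zero fun p hp => ?_
  have := Finset.HasAntidiagonal.mem_antidiagonal.mp hp
  by_cases h : N < p.1
  · rw [hA _ h, zero_mul]
  · rw [hB _ (by omega), mul_zero]

theorem degLE_one (N : ℕ) : DegLE N (1 : R⟦X⟧) := fun l hl => by
  rw [coeff_one, if_neg (by omega)]

theorem degLE_natCast (N k : ℕ) : DegLE N (k : R⟦X⟧) := fun l hl => by
  rw [← map_natCast (C (R := R)), coeff_C, if_neg (by omega)]

theorem degLE_zero (N : ℕ) : DegLE N (0 : R⟦X⟧) := fun l _ => by simp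

theorem degLE_X_pow (k : ℕ) : DegLE k (X ^ k : R⟦X⟧) := fun l hl => by
  rw [coeff_X_pow, if_neg (by omega)]

theorem DegLE.pow {N : ℕ} {A : R⟦X⟧} (hA : DegLE N A) (k : ℕ) : DegLE (N * k) (A ^ k) := by
  induction k with
  | zero => exact degLE_one _
  | succ k ih => rw [pow_succ]; exact (ih.mul hA).mono (by rw [Nat.mul_succ])

theorem DegLE.map {N : ℕ} {A : R⟦X⟧} (hA : DegLE N A) (π : R →+* S) :
    DegLE N (PowerSeries.map π A) := fun l hl => by rw [coeff_map, hA l hl, map_zero]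

theorem degLE_trunc (N : ℕ) (A : R⟦X⟧) : DegLE N (trunc (N + 1) A : R⟦X⟧) := fun l hl => by
  rw [Polynomial.coeff_coe, coeff_trunc, if_neg (by omega)]

theorem coeff_coe_trunc {N l : ℕ} (h : l ≤ N) (A : R⟦X⟧) :
    coeff l (trunc (N + 1) A : R⟦X⟧) = coeff l A := by
  rw [Polynomial.coeff_coe, coeff_trunc, if_pos (by omega)]

/-- If `A * G` has degree at most `N`, `G` has degree at most `r` and constant term `1`, and the
`r` coefficients of `A` up to the `N`-th vanish, then `A` has degree at most `N - r`. -/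
theorem degLE_of_mul {N r : ℕ} (hrN : r ≤ N) {A G : R⟦X⟧} (hG0 : constantCoeff G = 1)
    (hG : DegLE r G) (hAG : DegLE N (A * G))
    (hA : ∀ l, N - r < l → l ≤ N → coeff l A = 0) : DegLE (N - r) A := by
  intro l
  induction l using Nat.strong_induction_on with
  | _ l ih =>
    intro hl
    by_cases hlN : l ≤ N
    · exact hA l hl hlN
    have h := hAG l (by omega)
    -- The r coefficients of `A` just before the `l`-th vanish, so the `l`-th coefficient of `A * G`
    -- is that of `A`.
    rw [coeff_mul, Finset.sum_eq_single (l, 0)] at h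
    · simpa [hG0] using h
    · rintro ⟨p, q⟩ hp hne
      have := Finset.HasAntidiagonal.mem_antidiagonal.mp hp
      simp only at this ⊢
      by_cases hq : r < q
      · rw [hG _ hq, mul_zero]
      · have : q ≠ 0 := fun h0 => hne (by simp only [Prod.mk.injEq]; omega)
        rw [ih p (by omega) (by omega), zero_mul]
    · intro h0
      exact absurd (Finset.HasAntidiagonal.mem_antidiagonal.mpr (by simp)) h0

theorem coeff_mul_X_pow_of_lt {A : R⟦X⟧} {l k : ℕ} (h : l < k) : coeff l (A * X ^ k) = 0 := by
  rw [coeff_mul_X_pow', if_neg (by omega)]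

theorem constantCoeff_map_series (π : R →+* S) (A : R⟦X⟧) :
    constantCoeff (PowerSeries.map π A) = π (constantCoeff A) := by
  rw [← coeff_zero_eq_constantCoeff_apply, coeff_map, coeff_zero_eq_constantCoeff_apply]

theorem constantCoeff_of_mul_eq_one {A B : R⟦X⟧} (hA : constantCoeff A = 1) (h : A * B = 1) :
    constantCoeff B = 1 := by
  have := congrArg constantCoeff h
  simpa [hA] using this

end DegLE

/-! ### Coefficientwise derivations -/

section tangent
variable {R S : Type*} [CommRing R] [CommRing S]

/-- Apply the derivation `D` to every coefficient and reduce along `π`. -/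
def tangent (π : R →+* S) (D : Derivation ℤ R R) (A : R⟦X⟧) : S⟦X⟧ :=
  PowerSeries.mk fun l => π (D (coeff l A))

@[simp]
theorem coeff_tangent (π : R →+* S) (D : Derivation ℤ R R) (A : R⟦X⟧) (l : ℕ) :
    coeff l (tangent π D A) = π (D (coeff l A)) := coeff_mk _ _

theorem tangent_mul (π : R →+* S) (D : Derivation ℤ R R) (A B : R⟦X⟧) :
    tangent π D (A * B) = map π A * tangent π D B + map π B * tangent π D A := by
  ext l
  rw [coeff_tangent, coeff_mul, map_sum, map_sum, map_add, mul_comm (map π B), coeff_mul,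
    coeff_mul, ← Finset.sum_add_distrib]
  refine Finset.sum_congr rfl fun p _ => ?_
  simp only [Derivation.leibniz, smul_eq_mul, map_add, map_mul, coeff_map, coeff_tangent]
  ring

theorem tangent_one (π : R →+* S) (D : Derivation ℤ R R) : tangent π D 1 = 0 := by
  ext l
  rw [coeff_tangent, coeff_one]
  split_ifs <;> simp

theorem tangent_sub (π : R →+* S) (D : Derivation ℤ R R) (A B : R⟦X⟧) :
    tangent π D (A - B) = tangent π D A - tangent π D B := by
  ext l; simp

/-- Leibniz rule for a power of an inverse. -/
theorem tangent_inv_pow (π : R →+* S) (D : Derivation ℤ R R) {G Gi : R⟦X⟧} (h : G * Gi = 1)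
    (k : ℕ) : tangent π D (Gi ^ k) = -(k : S⟦X⟧) * map π Gi ^ (k + 1) * tangent π D G := by
  have h1 : map π G * map π Gi = 1 := by rw [← map_mul, h, map_one]
  have h2 : map π G * tangent π D Gi + map π Gi * tangent π D G = 0 := by
    rw [← tangent_mul, h, tangent_one]
  have h3 : tangent π D Gi = -map π Gi ^ 2 * tangent π D G := by
    linear_combination map π Gi * h2 - tangent π D Gi * h1
  induction k with
  | zero => simp [tangent_one]
  | succ k ih =>
    rw [pow_succ, tangent_mul, ih, h3, map_pow]
    push_cast
    ring

theorem tangent_mul_inv_pow (π : R →+* S) (D : Derivation ℤ R R) {F G Gi : R⟦X⟧}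
    (h : G * Gi = 1) (k : ℕ) : tangent π D (F * Gi ^ k) =
      map π Gi ^ k * tangent π D F - k * map π F * map π Gi ^ (k + 1) * tangent π D G := by
  rw [tangent_mul, tangent_inv_pow π D h, map_pow]
  ring

theorem degLE_tangent (π : R →+* S) (D : Derivation ℤ R R) {N : ℕ} {A : R⟦X⟧}
    (hA : DegLE N A) : DegLE N (tangent π D A) := fun l hl => by simp [hA l hl]

end tangent

/-! ### Ideals of minors -/

section minors
variable {σ R : Type*} [CommRing R]

/-- The ideal spanned by `J` and the minors of order `k` of the matrices `(∂_j f_i)`, `f_i ∈ J`. -/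
def minorExt (d : σ → Derivation ℤ R R) (k : ℕ) (J : Ideal R) : Ideal R :=
  J ⊔ Ideal.span {φ | ∃ (f : Fin k → R) (c : Fin k → σ), (∀ i, f i ∈ J) ∧
    φ = Matrix.det (Matrix.of fun i j => d (c j) (f i))}

/-- The derivation `∑ v_l ∂_l`. -/
def vectorField [Fintype σ] (d : σ → Derivation ℤ R R) (v : σ → R) : Derivation ℤ R R := ∑ l, v l • d l

theorem vectorField_apply [Fintype σ] (d : σ → Derivation ℤ R R) (v : σ → R) (f : R) :
    vectorField d v f = ∑ l, v l * d l f := by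
  have : vectorField d v f = (Derivation.coeFnAddMonoidHom (vectorField d v)) f := rfl
  rw [this, vectorField, map_sum, Finset.sum_apply]
  rfl

theorem vectorField_single [Fintype σ] [DecidableEq σ] (d : σ → Derivation ℤ R R) (l : σ) :
    vectorField d (Pi.single l 1) = d l := by
  ext f
  rw [vectorField_apply, Finset.sum_eq_single l]
  · simp
  · intro b _ hb; simp [hb]
  · simp

/-- Minors with respect to arbitrary vector fields belong to the Jacobian extension. -/
theorem det_vectorField_mem [Fintype σ] {ι : Type*} [Fintype ι] [DecidableEq ι]
    (d : σ → Derivation ℤ R R) {k : ℕ} (hk : Fintype.card ι = k) {J : Ideal R}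
    (f : ι → R) (hf : ∀ i, f i ∈ J) (v : ι → σ → R) :
    Matrix.det (Matrix.of fun i j => vectorField d (v j) (f i)) ∈ minorExt d k J := by
  classical
  let e : Fin k ≃ ι := (Fintype.equivFinOfCardEq hk).symm
  -- The determinant is expanded multilinearly in the vector fields. These index columns, while
  -- `detRowAlternating` is multilinear in rows, hence the transpose.
  rw [← Matrix.det_submatrix_equiv_self e, ← Matrix.det_transpose]
  have h : Matrix.det (Matrix.transpose (Matrix.submatrix
      (Matrix.of fun i j => vectorField d (v j) (f i)) e e)) =
      Matrix.detRowAlternating.toMultilinearMap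
        (fun j : Fin k => ∑ l, v (e j) l • fun i : Fin k => d l (f (e i))) := by
    refine congrArg Matrix.det ?_
    ext j i
    rw [Finset.sum_apply]
    simp [vectorField_apply]
  rw [h, MultilinearMap.map_sum]
  refine Ideal.sum_mem _ fun c _ => ?_
  rw [MultilinearMap.map_smul_univ]
  refine Ideal.mul_mem_left _ _ (Ideal.mem_sup_right (Ideal.subset_span ?_))
  refine ⟨fun i => f (e i), c, fun i => hf _, ?_⟩
  rw [← Matrix.det_transpose]
  rfl

/-- If, modulo `K`, the differentials of the elements of `J` lie in a module with `N` generators,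
then all minors of order `N + 1` lie in `K`. -/
theorem minorExt_le {S : Type*} [CommRing S] (d : σ → Derivation ℤ R R) (π : R →+* S)
    {J : Ideal R} (hJ : J ≤ RingHom.ker π) {T : Set R} (hT : J = Ideal.span T)
    {ι : Type*} [Fintype ι] {N : ℕ} (hN : Fintype.card ι = N) (ω : ι → σ → S)
    (hω : ∀ f ∈ T, (fun l => π (d l f)) ∈ Submodule.span S (Set.range ω)) :
    minorExt d (N + 1) J ≤ RingHom.ker π := by
  have hall : ∀ f ∈ J, (fun l => π (d l f)) ∈ Submodule.span S (Set.range ω) := by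
    intro f hf
    rw [hT] at hf hJ
    induction hf using Submodule.span_induction with
    | mem x hx => exact hω x hx
    | zero => convert Submodule.zero_mem _ using 1; ext l; simp
    | add x y _ _ hx hy => convert Submodule.add_mem _ hx hy using 1; ext l; simp
    | smul a x hx' hx =>
      convert Submodule.smul_mem _ (π a) hx using 1
      ext l
      -- This removes the Leibniz term x · da, so only the generators of `J` matter.
      have : π x = 0 := hJ hx'
      simp [this]
  refine sup_le hJ (Ideal.span_le.mpr ?_)
  rintro _ ⟨f, c, hf, rfl⟩
  let e : Fin N ≃ ι := (Fintype.equivFinOfCardEq hN).symm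
  have hex : ∀ i, ∃ A : ι → S, ∑ u, A u • ω u = fun l => π (d l (f i)) := fun i =>
    (Submodule.mem_span_range_iff_exists_fun S).mp (hall _ (hf i))
  choose A hA using hex
  rw [SetLike.mem_coe, RingHom.mem_ker, RingHom.map_det]
  -- The matrix factors through the `N` generators. Padding with a zero column and a zero row makes
  -- both factors square, and the first one singular.
  have hprod : π.mapMatrix (Matrix.of fun i j => d (c j) (f i)) =
      (Matrix.of fun i => (Fin.snoc (fun u => A i (e u)) 0 : Fin (N + 1) → S)) *
        (Matrix.of fun (u : Fin (N + 1)) j =>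
          (Fin.snoc (fun u => ω (e u) (c j)) 0 : Fin (N + 1) → S) u) := by
    ext i j
    have h := congrFun (hA i) (c j)
    rw [Finset.sum_apply, ← Equiv.sum_comp e] at h
    simp only [Pi.smul_apply, smul_eq_mul] at h
    rw [Matrix.mul_apply, Fin.sum_univ_castSucc]
    simp [h]
  rw [hprod, Matrix.det_mul, Matrix.det_eq_zero_of_column_eq_zero (Fin.last N), zero_mul]
  intro i
  simp

end minors

/-! ### Generic pairs of series -/

section pair
variable {R S : Type*} [CommRing R] [CommRing S] {n r : ℕ}

/-- `F = 1 + ∑ a_{n-l} X^l` and `G = 1 + ∑ b_{r-l} X^l`, where `d` are the partial derivatives with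
respect to coordinates `a_0, …, a_{n-1}, b_0, …, b_{r-1}`. -/
structure CoordPair (n r : ℕ) (d : Fin n ⊕ Fin r → Derivation ℤ R R) (F G : R⟦X⟧) : Prop where
  constF : constantCoeff F = 1
  constG : constantCoeff G = 1
  degF : DegLE n F
  degG : DegLE r G
  dFa : ∀ (i : Fin n) l, d (Sum.inl i) (coeff l F) = if l = n - i then 1 else 0
  dFb : ∀ (j : Fin r) l, d (Sum.inr j) (coeff l F) = 0
  dGa : ∀ (i : Fin n) l, d (Sum.inl i) (coeff l G) = 0
  dGb : ∀ (j : Fin r) l, d (Sum.inr j) (coeff l G) = if l = r - j then 1 else 0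

/-- The coefficient of `X^(n-k)` in `F / G^(k/r+1)`. -/
def quotCoeff (n r : ℕ) (F Gi : R⟦X⟧) (k : ℕ) : R := coeff (n - k) (F * Gi ^ (k / r + 1))

/-- The coefficients of `F * G` together with the first `s * r` quotient coefficients. -/
def stageGens (n r : ℕ) (F G Gi : R⟦X⟧) (s : ℕ) : Set R :=
  {x | ∃ l, 1 ≤ l ∧ x = coeff l (F * G)} ∪ {x | ∃ k, k < s * r ∧ x = quotCoeff n r F Gi k}

/-- The ideal of the `s`-th successive critical extension. -/
def stageIdeal (n r : ℕ) (F G Gi : R⟦X⟧) (s : ℕ) : Ideal R :=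
  Ideal.span (stageGens n r F G Gi s)

theorem sum_coeff_sub_ite {N : ℕ} {W : S⟦X⟧} (hW0 : constantCoeff W = 0) (hW : DegLE N W) (l : ℕ) :
    ∑ i : Fin N, coeff (N - i) W * (if l = N - i then 1 else 0) = coeff l W := by
  by_cases hl : 1 ≤ l ∧ l ≤ N
  · rw [Finset.sum_eq_single (⟨N - l, by omega⟩ : Fin N)]
    · have : N - (N - l) = l := by omega
      simp [this]
    · intro b _ hb
      rw [if_neg, mul_zero]
      intro h
      exact hb (Fin.ext (by simp only; omega))
    · simp
  · rw [Finset.sum_eq_zero]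
    · rcases Nat.eq_zero_or_pos l with rfl | h
      · simpa using hW0.symm
      · exact (hW l (by omega)).symm
    · intro i _
      rw [if_neg (by omega), mul_zero]

variable {d : Fin n ⊕ Fin r → Derivation ℤ R R} {F G Gi : R⟦X⟧}

/-- The nonconstant coefficients of F and G behave as independent coordinates, so F and G can be
moved independently in every direction that the degrees allow. -/
theorem CoordPair.exists_vectorField (h : CoordPair n r d F G) {π : R →+* S}
    (hπ : Function.Surjective π) {W Z : S⟦X⟧} (hW0 : constantCoeff W = 0) (hW : DegLE n W)
    (hZ0 : constantCoeff Z = 0) (hZ : DegLE r Z) :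
    ∃ v, tangent π (vectorField d v) F = W ∧ tangent π (vectorField d v) G = Z := by
  choose g hg using hπ
  refine ⟨Sum.elim (fun i => g (coeff (n - i) W)) (fun j => g (coeff (r - j) Z)), ?_, ?_⟩
  · ext l
    rw [coeff_tangent, vectorField_apply, Fintype.sum_sum_type]
    simp only [h.dFa, h.dFb, Sum.elim_inl, mul_zero, Finset.sum_const_zero, add_zero, map_sum,
      map_mul, hg]
    rw [← sum_coeff_sub_ite hW0 hW l]
    refine Finset.sum_congr rfl fun i _ => ?_
    split_ifs <;> simp
  · ext l
    rw [coeff_tangent, vectorField_apply, Fintype.sum_sum_type]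
    simp only [h.dGa, h.dGb, Sum.elim_inr, mul_zero, Finset.sum_const_zero, zero_add, map_sum,
      map_mul, hg]
    rw [← sum_coeff_sub_ite hZ0 hZ l]
    refine Finset.sum_congr rfl fun i _ => ?_
    split_ifs <;> simp

theorem CoordPair.tangent_F_inl (h : CoordPair n r d F G) (π : R →+* S) (i : Fin n) :
    tangent π (d (Sum.inl i)) F = X ^ (n - i : ℕ) := by
  ext l
  rw [coeff_tangent, h.dFa, coeff_X_pow]
  split_ifs <;> simp

theorem CoordPair.tangent_G_inl (h : CoordPair n r d F G) (π : R →+* S) (i : Fin n) :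
    tangent π (d (Sum.inl i)) G = 0 := by
  ext l
  rw [coeff_tangent, h.dGa, map_zero, map_zero]

/-- Where the first `s * r` quotient coefficients vanish, `F / G^s` is a polynomial of degree at
most `n - s * r`. -/
theorem CoordPair.degLE_quot (h : CoordPair n r d F G) (hGi : G * Gi = 1) (hr : 0 < r)
    (π : R →+* S) (s : ℕ) (hs : s * r ≤ n)
    (hπ : ∀ k < s * r, π (quotCoeff n r F Gi k) = 0) :
    DegLE (n - s * r) (map π (F * Gi ^ s)) := by
  induction s with
  | zero => simpa using h.degF.map π
  | succ s ih =>
    rw [Nat.succ_mul] at hs hπ ⊢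
    have ih := ih (by omega) fun k hk => hπ k (by omega)
    have hmul : map π (F * Gi ^ (s + 1)) * map π G = map π (F * Gi ^ s) := by
      rw [← map_mul]
      congr 1
      linear_combination F * Gi ^ s * hGi
    rw [← hmul] at ih
    rw [← Nat.sub_sub]
    refine degLE_of_mul (by omega) ?_ (h.degG.map π) ih ?_
    · rw [constantCoeff_map_series, h.constG, map_one]
    · intro l hl hl'
      have hk := hπ (n - l) (by omega)
      -- The window of r degrees just below the old bound corresponds exactly to the indices k with
      -- k / r = s.
      have hdiv : (n - l) / r = s := by
        rw [Nat.div_eq_iff hr]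
        constructor
        · omega
        · have : (s + 1) * r = s * r + r := Nat.succ_mul s r
          omega
      rwa [quotCoeff, hdiv, Nat.sub_sub_self (by omega), ← coeff_map] at hk

theorem stageIdeal_kills {π : R →+* S} {s : ℕ}
    (hJ : stageIdeal n r F G Gi s ≤ RingHom.ker π) :
    (∀ l, 1 ≤ l → π (coeff l (F * G)) = 0) ∧ ∀ k < s * r, π (quotCoeff n r F Gi k) = 0 :=
  ⟨fun l hl => hJ (Ideal.subset_span (Or.inl ⟨l, hl, rfl⟩)),
    fun k hk => hJ (Ideal.subset_span (Or.inr ⟨k, hk, rfl⟩))⟩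

theorem CoordPair.map_mul_eq_one (h : CoordPair n r d F G) {π : R →+* S}
    (hπ : ∀ l, 1 ≤ l → π (coeff l (F * G)) = 0) : map π (F * G) = 1 := by
  ext l
  rcases Nat.eq_zero_or_pos l with rfl | hl
  · rw [coeff_zero_eq_constantCoeff_apply, constantCoeff_map_series, map_mul, h.constF, h.constG]
    simp
  · rw [coeff_map, hπ l hl, coeff_one, if_neg (by omega)]

/-- The derivatives of the quotient coefficients along a vector field that moves `F / G^s` by `Y`
and `G` by `Z` vanish. -/
theorem CoordPair.map_vectorField_quotCoeff (h : CoordPair n r d F G) (hGi : G * Gi = 1)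
    (hr : 0 < r) {π : R →+* S} {s : ℕ} (hs : s * r ≤ n)
    (hJ : ∀ k < s * r, π (quotCoeff n r F Gi k) = 0) {Y Z : S⟦X⟧} (hY : DegLE (n - s * r) Y)
    (hZ : DegLE r Z) {D : Derivation ℤ R R} (hDG : tangent π D G = Z)
    (hDF : tangent π D F = map π G ^ s * Y + s * (map π F * map π Gi * Z)) {k : ℕ}
    (hk : k < s * r) : π (D (quotCoeff n r F Gi k)) = 0 := by
  have hg : map π G * map π Gi = 1 := by rw [← map_mul, hGi, map_one]
  have hQ := h.degLE_quot hGi hr π s hs hJ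
  rw [map_mul, map_pow] at hQ
  have hgd := h.degG.map π
  obtain ⟨p, hp⟩ : ∃ p, s = k / r + 1 + p :=
    Nat.exists_eq_add_of_le ((Nat.div_lt_iff_lt_mul hr).mpr hk)
  have hkr : k < (k / r + 1) * r := by
    rw [mul_comm]; exact Nat.lt_mul_div_succ k hr
  rw [quotCoeff, ← coeff_tangent, tangent_mul_inv_pow π D hGi, hDG, hDF]
  generalize map π G = g at *
  generalize map π Gi = gi at *
  generalize map π F = f at *
  generalize k / r + 1 = q at *
  have hgq : g ^ q * gi ^ q = 1 := by rw [← mul_pow, hg, one_pow]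
  have hgp : ∀ p, g ^ p * gi ^ p = 1 := fun p => by rw [← mul_pow, hg, one_pow]
  -- This is the variation of F/G^q = (F/G^s) G^p, where p = s - q. The truncated `p - 1` is
  -- harmless, since its term carries the factor p. Both summands have degree at most n - qr, which
  -- is below n - k.
  have key : gi ^ q * (g ^ s * Y + s * (f * gi * Z)) - q * f * gi ^ (q + 1) * Z =
      g ^ p * Y + p * (f * gi ^ s * g ^ (p - 1) * Z) := by
    subst hp
    rcases p with _ | p
    · simp only [add_zero, pow_zero, Nat.cast_zero, zero_mul]
      linear_combination Y * hgq
    · rw [Nat.add_sub_cancel]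
      push_cast
      linear_combination g ^ (p + 1) * Y * hgq - (p + 1) * f * Z * gi ^ (q + 1) * hgp p
  rw [key]
  have hsr : s * r = q * r + p * r := by rw [hp, add_mul]
  refine DegLE.add (N := n - q * r) ?_ ?_ _ (by omega)
  · refine ((hgd.pow p).mul hY).mono ?_
    have := mul_comm r p
    omega
  · rcases p with _ | p
    · simpa using degLE_zero _
    · rw [Nat.add_sub_cancel]
      have hdeg := (degLE_natCast (R := S) 0 (p + 1)).mul ((hQ.mul (hgd.pow p)).mul hZ)
      refine hdeg.mono ?_
      rw [Nat.succ_mul] at hsr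
      have := mul_comm r p
      omega

end pair

/-! ### Lower and upper bounds for the minors -/

section minorBounds
variable {R S : Type*} [CommRing R] [CommRing S] {n r : ℕ}
variable {d : Fin n ⊕ Fin r → Derivation ℤ R R} {F G Gi : R⟦X⟧}

/-- Modulo the `s`-th stage ideal, every determinant of the coefficients of
`A * ((s + 1) F Z_j + G^(s+1) Y_j)` is a minor of order `s * r + N`. -/
theorem CoordPair.exists_mem_minorExt (h : CoordPair n r d F G) (hGi : G * Gi = 1)
    (hr : 0 < r) {π : R →+* S} (hsurj : Function.Surjective π) {s : ℕ} (hs : s * r ≤ n)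
    (hker : stageIdeal n r F G Gi s = RingHom.ker π) (A : R⟦X⟧) {N : ℕ} (Y Z : Fin N → S⟦X⟧)
    (hY0 : ∀ j, constantCoeff (Y j) = 0) (hY : ∀ j, DegLE (n - s * r) (Y j))
    (hZ0 : ∀ j, constantCoeff (Z j) = 0) (hZ : ∀ j, DegLE r (Z j)) :
    ∃ x ∈ minorExt d (s * r + N) (stageIdeal n r F G Gi s),
      π x = Matrix.det (Matrix.of fun l j : Fin N => coeff (l + 1)
        (map π A * (((s : S⟦X⟧) + 1) * map π F * Z j + map π G ^ (s + 1) * Y j))) := by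
  obtain ⟨hH, he⟩ := stageIdeal_kills hker.le
  have hFG : map π F * map π G = 1 := by rw [← map_mul, h.map_mul_eq_one hH]
  have hg : map π G * map π Gi = 1 := by rw [← map_mul, hGi, map_one]
  have hQ := h.degLE_quot hGi hr π s hs he
  rw [map_mul, map_pow] at hQ
  have hgd := h.degG.map π
  -- This is the variation of F when F/G^s varies by Y and G by Z. For s > 0, its degree is bounded
  -- by writing F/G as (F/G^s) G^(s-1).
  have hW : ∀ j, DegLE n (map π G ^ s * Y j + (s : S⟦X⟧) * (map π F * map π Gi * Z j)) := by
    intro j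
    refine DegLE.add (((hgd.pow s).mul (hY j)).mono ?_) ?_
    · have := mul_comm r s
      omega
    · rcases s with _ | s
      · simpa using degLE_zero _
      · have hdeg := (degLE_natCast (R := S) 0 (s + 1)).mul ((hQ.mul (hgd.pow s)).mul (hZ j))
        have e : map π F * map π Gi ^ (s + 1) * map π G ^ s = map π F * map π Gi := by
          have : map π G ^ s * map π Gi ^ s = 1 := by rw [← mul_pow, hg, one_pow]
          linear_combination map π F * map π Gi * this
        rw [e] at hdeg
        refine hdeg.mono ?_
        rw [Nat.succ_mul] at hs ⊢
        have := mul_comm r s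
        omega
  have hv : ∀ j, ∃ v, tangent π (vectorField d v) F =
        map π G ^ s * Y j + (s : S⟦X⟧) * (map π F * map π Gi * Z j) ∧
      tangent π (vectorField d v) G = Z j := fun j =>
    h.exists_vectorField hsurj (by simp [hY0, hZ0]) (hW j) (hZ0 j) (hZ j)
  choose v hvF hvG using hv
  -- Subtracting 1 from FG puts the coefficients in the ideal and makes the derivative of `A` drop
  -- out.
  let f : Fin (s * r) ⊕ Fin N → R := Sum.elim (fun k => quotCoeff n r F Gi k)
    (fun l => coeff (l + 1) (A * (F * G - 1)))
  let w : Fin (s * r) ⊕ Fin N → Fin n ⊕ Fin r → R := Sum.elim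
    (fun k => Pi.single (Sum.inl ⟨k, by omega⟩) 1) v
  have hf : ∀ i, f i ∈ stageIdeal n r F G Gi s := by
    rintro (k | l)
    · exact Ideal.subset_span (Or.inr ⟨k, k.2, rfl⟩)
    · rw [hker, RingHom.mem_ker]
      simp only [f, Sum.elim_inr]
      rw [← coeff_map, map_mul, map_sub, map_one, h.map_mul_eq_one hH, sub_self, mul_zero,
        map_zero]
  refine ⟨_, det_vectorField_mem d (by simp) f hf w, ?_⟩
  rw [RingHom.map_det]
  -- The fields `v j` annihilate the quotient coefficients, whence the zero block; the ∂/∂a_k form a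
  -- unitriangular block against them.
  have hblock : π.mapMatrix (Matrix.of fun i j => vectorField d (w j) (f i)) =
      Matrix.fromBlocks
        (Matrix.of fun k' k : Fin (s * r) =>
          π (vectorField d (w (Sum.inl k)) (f (Sum.inl k')))) 0
        (Matrix.of fun l k => π (vectorField d (w (Sum.inl k)) (f (Sum.inr l))))
        (Matrix.of fun l j : Fin N => coeff (l + 1)
          (map π A * (((s : S⟦X⟧) + 1) * map π F * Z j + map π G ^ (s + 1) * Y j))) := by
    ext (i | i) (j | j)
    · rfl
    · simp only [RingHom.mapMatrix_apply, Matrix.map_apply, Matrix.of_apply,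
        Matrix.fromBlocks_apply₁₂, Matrix.zero_apply]
      exact h.map_vectorField_quotCoeff hGi hr hs he (hY j) (hZ j) (hvG j) (hvF j) i.2
    · rfl
    · simp only [RingHom.mapMatrix_apply, Matrix.map_apply, Matrix.of_apply,
        Matrix.fromBlocks_apply₂₂, f, w, Sum.elim_inr]
      rw [← coeff_tangent, tangent_mul, tangent_sub, tangent_mul, tangent_one, map_sub, map_mul,
        hFG, map_one, hvF, hvG]
      congr 1
      linear_combination map π A * s * map π F * Z j * hg
  rw [hblock, Matrix.det_fromBlocks_zero₁₂, Matrix.det_of_isUpperTriangular]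
  · rw [Finset.prod_eq_one, one_mul]
    intro k _
    simp only [Matrix.of_apply, f, w, Sum.elim_inl, quotCoeff]
    rw [vectorField_single, ← coeff_tangent, tangent_mul_inv_pow _ _ hGi, h.tangent_F_inl,
      h.tangent_G_inl, mul_zero, sub_zero, coeff_mul_X_pow', if_pos le_rfl]
    have : constantCoeff (map π Gi) = 1 :=
      constantCoeff_of_mul_eq_one (by rw [constantCoeff_map_series, h.constG, map_one]) hg
    simp [this]
  · intro i j hij
    have hij' : j < i := hij
    simp only [Matrix.of_apply, f, w, Sum.elim_inl, quotCoeff]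
    rw [vectorField_single, ← coeff_tangent, tangent_mul_inv_pow _ _ hGi, h.tangent_F_inl,
      h.tangent_G_inl, mul_zero, sub_zero]
    exact coeff_mul_X_pow_of_lt (by simp only; omega)

/-- Since `J` is the kernel of the surjection `π` and lies in the extension, an inverse modulo `J`
can be lifted and used there. -/
theorem minorExt_eq_top_of_isUnit {π : R →+* S} (hsurj : Function.Surjective π) {J : Ideal R}
    (hker : J = RingHom.ker π) {k : ℕ} {x : R} (hx : x ∈ minorExt d k J) (hu : IsUnit (π x)) :
    minorExt d k J = ⊤ := by
  obtain ⟨y, hy⟩ := hu.exists_right_inv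
  obtain ⟨z, rfl⟩ := hsurj y
  rw [Ideal.eq_top_iff_one]
  have h1 : 1 - x * z ∈ J := by
    rw [hker, RingHom.mem_ker, map_sub, map_mul, hy, map_one, sub_self]
  have := Ideal.add_mem _ ((le_sup_left : J ≤ minorExt d k J) h1) (Ideal.mul_mem_right z _ hx)
  rwa [sub_add_cancel] at this

theorem mem_minorExt_of_isUnit_mul {π : R →+* S} (hsurj : Function.Surjective π) {J : Ideal R}
    (hker : J = RingHom.ker π) {k : ℕ} {x y : R} (hx : x ∈ minorExt d k J) {u : S}
    (hu : IsUnit u) (hxy : π x = u * π y) : y ∈ minorExt d k J := by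
  obtain ⟨c, hc⟩ := hu.exists_left_inv
  obtain ⟨z, rfl⟩ := hsurj c
  have h1 : y - z * x ∈ J := by
    rw [hker, RingHom.mem_ker, map_sub, map_mul, hxy, ← mul_assoc, hc, one_mul, sub_self]
  have := Ideal.add_mem _ ((le_sup_left : J ≤ minorExt d k J) h1) (Ideal.mul_mem_left _ z hx)
  rwa [sub_add_cancel] at this

/-- The upper bound for the minors of order `s * r + N + 1`, where `A` is a unit power series such
that `F * A` and `G^(s+1) * A` reduce to polynomials of small degree. -/
theorem CoordPair.minorExt_stageIdeal_le (h : CoordPair n r d F G) (hGi : G * Gi = 1)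
    (hr : 0 < r) {π : R →+* S} {s : ℕ} (hs : s * r ≤ n)
    (hJ : stageIdeal n r F G Gi s ≤ RingHom.ker π) {A E : R⟦X⟧} (hA : A * E = 1) {N : ℕ}
    (hrN : r ≤ N) (hnN : n - s * r ≤ N) (hFA : DegLE (N - r) (map π (F * A)))
    (hGA : DegLE (N - (n - s * r)) (map π (G ^ (s + 1) * A))) :
    minorExt d (s * r + N + 1) (stageIdeal n r F G Gi s) ≤ RingHom.ker π := by
  obtain ⟨hH, he⟩ := stageIdeal_kills hJ
  -- the generating forms
  let form : ℕ → Fin n ⊕ Fin r → S := fun q j => coeff q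
    (((s : S⟦X⟧) + 1) * map π (F * A) * tangent π (d j) G +
      map π (G ^ (s + 1) * A) * tangent π (d j) (F * Gi ^ s))
  let ω : Fin (s * r) ⊕ Fin N → Fin n ⊕ Fin r → S := Sum.elim
    (fun k j => π (d j (quotCoeff n r F Gi k))) (fun q => form (q + 1))
  let M := Submodule.span S (Set.range ω)
  have hquot : ∀ k < s * r, (fun j => π (d j (quotCoeff n r F Gi k))) ∈ M := fun k hk =>
    Submodule.subset_span ⟨Sum.inl ⟨k, hk⟩, rfl⟩
  -- differentials of the tail of `F / G^s`
  have htail : ∀ a, n - s * r < a → (fun j => π (d j (coeff a (F * Gi ^ s)))) ∈ M := by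
    intro a ha
    -- Vanishing under `π` says nothing about differentials. Applying the degree bound over R/I
    -- instead shows that the tail lies in the ideal of the quotient coefficients themselves.
    let I : Ideal R := Ideal.span {x | ∃ k, k < s * r ∧ x = quotCoeff n r F Gi k}
    have hmem : coeff a (F * Gi ^ s) ∈ I := by
      have := h.degLE_quot hGi hr (Ideal.Quotient.mk I) s hs
        (fun k hk => Ideal.Quotient.eq_zero_iff_mem.mpr (Ideal.subset_span ⟨k, hk, rfl⟩)) a ha
      rwa [coeff_map, Ideal.Quotient.eq_zero_iff_mem] at this
    have hI : ∀ x ∈ I, π x = 0 ∧ (fun j => π (d j x)) ∈ M := by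
      intro x hx
      induction hx using Submodule.span_induction with
      | mem x hx => obtain ⟨k, hk, rfl⟩ := hx; exact ⟨he k hk, hquot k hk⟩
      | zero => exact ⟨map_zero _, by convert Submodule.zero_mem M using 1; ext; simp⟩
      | add x y _ _ hx hy =>
        exact ⟨by rw [map_add, hx.1, hy.1, add_zero], by
          convert Submodule.add_mem _ hx.2 hy.2 using 1; ext l; simp⟩
      | smul c x _ hx =>
        exact ⟨by rw [smul_eq_mul, map_mul, hx.1, mul_zero], by
          convert Submodule.smul_mem _ (π c) hx.2 using 1; ext l; simp [hx.1]⟩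
    exact (hI _ hmem).2
  have hform : ∀ q, form q ∈ M := by
    intro q
    by_cases hq : 1 ≤ q ∧ q ≤ N
    · refine Submodule.subset_span ⟨Sum.inr ⟨q - 1, by omega⟩, ?_⟩
      simp only [ω, Sum.elim_inr, Nat.sub_add_cancel hq.1]
    have h1 : ∀ j, coeff q (((s : S⟦X⟧) + 1) * map π (F * A) * tangent π (d j) G) = 0 := by
      intro j
      rcases Nat.eq_zero_or_pos q with rfl | hq0
      · have : constantCoeff (tangent π (d j) G) = 0 := by
          rw [← coeff_zero_eq_constantCoeff_apply, coeff_tangent,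
            coeff_zero_eq_constantCoeff_apply, h.constG]
          simp
        rw [coeff_zero_eq_constantCoeff_apply, map_mul, this, mul_zero]
      · have := ((degLE_natCast (R := S) 0 (s + 1)).mul hFA).mul
          (degLE_tangent π (d j) h.degG)
        push_cast at this
        exact this q (by omega)
    have h2 : form q = ∑ p ∈ Finset.HasAntidiagonal.antidiagonal q, coeff p.1 (map π (G ^ (s + 1) * A)) •
        fun j => π (d j (coeff p.2 (F * Gi ^ s))) := by
      ext j
      simp only [form]
      rw [map_add, h1, zero_add, coeff_mul, Finset.sum_apply]
      simp
    rw [h2]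
    refine Submodule.sum_mem _ fun p hp => ?_
    have hpq := Finset.HasAntidiagonal.mem_antidiagonal.mp hp
    -- For q > N, either p.2 falls in the tail of F/G^s or p.1 exceeds the degree of G^(s+1) A.
    by_cases hp2 : n - s * r < p.2
    · exact Submodule.smul_mem _ _ (htail _ hp2)
    rcases Nat.eq_zero_or_pos q with hq0 | hq0
    · have h0 : p.2 = 0 := by omega
      have hGi0 := constantCoeff_of_mul_eq_one h.constG hGi
      convert Submodule.zero_mem M
      ext j
      simp [h0, hGi0, h.constF]
    · rw [hGA _ (by omega), zero_smul]
      exact Submodule.zero_mem _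
  refine minorExt_le d π hJ rfl (by simp) ω ?_
  rintro f (⟨l, -, rfl⟩ | ⟨k, hk, rfl⟩)
  · have hprod : F * G = G ^ (s + 1) * (F * Gi ^ s) := by
      have : G ^ s * Gi ^ s = 1 := by rw [← mul_pow, hGi, one_pow]
      linear_combination -F * G * this
    -- Multiplying back by `E`, the inverse of `A`, expresses the differentials of FG through the
    -- forms.
    have hrel : ∀ j, tangent π (d j) (F * G) = map π E *
        (((s : S⟦X⟧) + 1) * map π (F * A) * tangent π (d j) G +
          map π (G ^ (s + 1) * A) * tangent π (d j) (F * Gi ^ s)) := by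
      intro j
      have hAE : map π A * map π E = 1 := by rw [← map_mul, hA, map_one]
      have hgg : map π G * map π Gi = 1 := by rw [← map_mul, hGi, map_one]
      have hgs : map π G ^ s * map π Gi ^ s = 1 := by rw [← mul_pow, hgg, one_pow]
      rw [tangent_mul_inv_pow π _ hGi, tangent_mul]
      simp only [map_mul, map_pow]
      linear_combination (-(((s : S⟦X⟧) + 1) * map π F * tangent π (d j) G +
        map π G ^ (s + 1) * (map π Gi ^ s * tangent π (d j) F
          - s * map π F * map π Gi ^ (s + 1) * tangent π (d j) G))) * hAE
        - map π G * tangent π (d j) F * hgs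
        + s * map π F * tangent π (d j) G * (hgs * map π G * map π Gi + hgg)
    have : (fun j => π (d j (coeff l (F * G)))) =
        ∑ p ∈ Finset.HasAntidiagonal.antidiagonal l, coeff p.1 (map π E) • form p.2 := by
      ext j
      rw [← coeff_tangent, hrel, coeff_mul, Finset.sum_apply]
      rfl
    rw [this]
    exact Submodule.sum_mem _ fun p _ => Submodule.smul_mem _ _ (hform _)
  · exact hquot k hk

end minorBounds

/-! ### The critical extensions of a generic pair -/

section stages
variable {R S : Type*} [CommRing R] [CommRing S] {n r : ℕ}
variable {d : Fin n ⊕ Fin r → Derivation ℤ R R} {F G Gi : R⟦X⟧}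

theorem det_coeff_C_mul_X_pow (N : ℕ) (u : S) :
    Matrix.det (Matrix.of fun l j : Fin N => coeff (l + 1) (C u * X ^ (j + 1 : ℕ))) = u ^ N := by
  have : (Matrix.of fun l j : Fin N => coeff (l + 1) (C u * X ^ (j + 1 : ℕ))) =
      Matrix.diagonal fun _ => u := by
    ext l j
    rw [Matrix.of_apply, coeff_C_mul, coeff_X_pow, Matrix.diagonal_apply]
    simp [Fin.ext_iff]
  rw [this, Matrix.det_diagonal]
  simp

/-- Once the last column is cleared of its low-degree part, the determinant isolates its first
surviving coefficient. -/
theorem det_coeff_snoc {N : ℕ} (u : S) (V : Fin (N + 1) → S⟦X⟧)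
    (hV : ∀ j : Fin N, V j.castSucc = C u * X ^ (j + 1 : ℕ))
    (hlast : ∀ l < N, coeff (l + 1) (V (Fin.last N)) = 0) :
    Matrix.det (Matrix.of fun l j : Fin (N + 1) => coeff (l + 1) (V j)) =
      u ^ N * coeff (N + 1) (V (Fin.last N)) := by
  rw [Matrix.det_of_isLowerTriangular, Fin.prod_univ_castSucc]
  · simp [hV, coeff_C_mul, coeff_X_pow]
  · intro i j hij
    have hij' : i < j := hij
    induction j using Fin.lastCases with
    | last => exact hlast i hij'
    | cast j =>
      have : (i : ℕ) < j := hij'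
      rw [Matrix.of_apply, hV, coeff_mul_X_pow_of_lt (by omega)]

/-- The part of degree at most `N`, as a power series. -/
def truncSeries (N : ℕ) (T : S⟦X⟧) : S⟦X⟧ := (trunc (N + 1) T : S⟦X⟧)

theorem degLE_truncSeries (N : ℕ) (T : S⟦X⟧) : DegLE N (truncSeries N T) := degLE_trunc N T

theorem coeff_sub_trunc {N l : ℕ} (T : S⟦X⟧) :
    coeff l (T - truncSeries N T) = if l ≤ N then 0 else coeff l T := by
  rw [map_sub, truncSeries]
  split_ifs with h
  · rw [coeff_coe_trunc h, sub_self]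
  · rw [degLE_trunc N T l (by omega), sub_zero]

theorem constantCoeff_trunc (N : ℕ) (T : S⟦X⟧) :
    constantCoeff (truncSeries N T) = constantCoeff T := by
  rw [truncSeries, ← coeff_zero_eq_constantCoeff_apply, coeff_coe_trunc (Nat.zero_le _),
    coeff_zero_eq_constantCoeff_apply]

/-- The first critical extensions. -/
theorem CoordPair.minorExt_stageIdeal (h : CoordPair n r d F G) (hGi : G * Gi = 1)
    (hr : 0 < r) {s : ℕ} (hs : (s + 1) * r ≤ n) (hunit : IsUnit ((s : R) + 1)) :
    minorExt d (n + 1) (stageIdeal n r F G Gi s) = stageIdeal n r F G Gi (s + 1) ∧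
      minorExt d n (stageIdeal n r F G Gi s) = ⊤ := by
  have hsr : s * r + r ≤ n := by rwa [← Nat.succ_mul]
  have hN : s * r + (n - s * r) = n := by omega
  have hgG : ∀ k, G ^ k * Gi ^ k = 1 := fun k => by rw [← mul_pow, hGi, one_pow]
  have hmono : stageIdeal n r F G Gi s ≤ stageIdeal n r F G Gi (s + 1) := by
    refine Ideal.span_mono (Set.union_subset_union_right _ ?_)
    rintro x ⟨k, hk, rfl⟩
    exact ⟨k, by rw [Nat.succ_mul]; omega, rfl⟩
  have hsurj : Function.Surjective (Ideal.Quotient.mk (stageIdeal n r F G Gi s)) :=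
    Ideal.Quotient.mk_surjective
  have hker : stageIdeal n r F G Gi s =
      RingHom.ker (Ideal.Quotient.mk (stageIdeal n r F G Gi s)) := Ideal.mk_ker.symm
  obtain ⟨hH, he⟩ := stageIdeal_kills hker.le
  have key := fun N Y Z =>
    h.exists_mem_minorExt (N := N) hGi hr hsurj (by omega) hker (Gi ^ (s + 1)) Y Z
  generalize hπ : Ideal.Quotient.mk (stageIdeal n r F G Gi s) = π at *
  have hgπ : map π (Gi ^ (s + 1)) * map π G ^ (s + 1) = 1 := by
    rw [← map_pow, ← map_mul, mul_comm, hgG, map_one]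
  refine ⟨le_antisymm ?_ ?_, ?_⟩
  · have hker' := Ideal.mk_ker (I := stageIdeal n r F G Gi (s + 1))
    have := h.minorExt_stageIdeal_le hGi hr (s := s) (by omega) (hmono.trans hker'.ge)
      (A := Gi ^ (s + 1)) (E := G ^ (s + 1)) (by rw [mul_comm, hgG]) (N := n - s * r) (by omega)
      le_rfl ?_ ?_
    · rwa [hN, hker'] at this
    · have := h.degLE_quot hGi hr _ (s + 1) hs (stageIdeal_kills hker'.ge).2
      rwa [Nat.succ_mul, ← Nat.sub_sub] at this
    · rw [hgG, map_one]
      exact degLE_one _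
  · refine Ideal.span_le.mpr ?_
    rintro x (hx | ⟨k, hk, rfl⟩)
    · exact Ideal.mem_sup_left (Ideal.subset_span (Or.inl hx))
    by_cases hks : k < s * r
    · exact Ideal.mem_sup_left (Ideal.subset_span (Or.inr ⟨k, hks, rfl⟩))
    rw [Nat.succ_mul] at hk
    -- The effect of moving G by X^(k-sr+1). Compensating its truncation through Y leaves a series
    -- starting in degree n-sr+1, whose coefficient there is s+1 times the k-th quotient
    -- coefficient.
    let V := map π (Gi ^ (s + 1)) *
      ((((s : (R ⧸ stageIdeal n r F G Gi s)⟦X⟧) + 1) * map π F * X ^ (k - s * r + 1)))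
    obtain ⟨x, hx, hdet⟩ := key (n - s * r + 1)
      (Fin.snoc (fun j => X ^ (j + 1 : ℕ)) (-truncSeries (n - s * r) V))
      (Fin.snoc (fun j => 0) (X ^ (k - s * r + 1)))
      (by
        intro j
        induction j using Fin.lastCases with
        | last =>
          rw [Fin.snoc_last, map_neg, constantCoeff_trunc]
          simp [V]
        | cast j => simp)
      (by
        intro j
        induction j using Fin.lastCases with
        | last => simpa using (degLE_truncSeries _ V).neg
        | cast j => simpa using (degLE_X_pow _).mono (by omega))
      (by
        intro j
        induction j using Fin.lastCases with
        | last => simp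
        | cast j => simp)
      (by
        intro j
        induction j using Fin.lastCases with
        | last => simpa using (degLE_X_pow _).mono (by omega)
        | cast j => simpa using degLE_zero _)
    have hlast : map π (Gi ^ (s + 1)) *
        (((s : (R ⧸ stageIdeal n r F G Gi s)⟦X⟧) + 1) * map π F * X ^ (k - s * r + 1) +
          map π G ^ (s + 1) * -truncSeries (n - s * r) V) =
        V - truncSeries (n - s * r) V := by
      simp only [V]
      linear_combination -truncSeries (n - s * r) V * hgπ
    rw [det_coeff_snoc 1] at hdet
    · simp only [Fin.snoc_last] at hdet
      rw [hlast, coeff_sub_trunc, if_neg (by omega), one_pow, one_mul] at hdet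
      rw [← add_assoc, hN] at hx
      refine mem_minorExt_of_isUnit_mul hsurj hker hx (hunit.map π) ?_
      rw [hdet]
      have hdiv : k / r = s := by
        rw [Nat.div_eq_iff hr]
        constructor
        · omega
        · have : (s + 1) * r = s * r + r := Nat.succ_mul s r
          omega
      have hV : V = C (π (s + 1)) * map π (F * Gi ^ (s + 1)) * X ^ (k - s * r + 1) := by
        simp only [V, map_add, map_mul, map_natCast, map_one]
        ring
      rw [hV, coeff_mul_X_pow', if_pos (by omega), coeff_C_mul, coeff_map, quotCoeff, hdiv]
      congr 4
      omega
    · intro j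
      simp only [Fin.snoc_castSucc, map_one, one_mul, mul_zero, zero_add]
      linear_combination X ^ (j + 1 : ℕ) * hgπ
    · intro l hl
      simp only [Fin.snoc_last]
      rw [hlast, coeff_sub_trunc, if_pos (by omega)]
  · obtain ⟨x, hx, hdet⟩ := key (n - s * r) (fun j => X ^ (j + 1 : ℕ)) 0 (by simp)
      (fun j => (degLE_X_pow _).mono (by omega)) (by simp) (fun j => degLE_zero _)
    rw [hN] at hx
    refine minorExt_eq_top_of_isUnit hsurj hker hx ?_
    have hj : ∀ j : Fin (n - s * r), map π (Gi ^ (s + 1)) *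
        (((s : (R ⧸ stageIdeal n r F G Gi s)⟦X⟧) + 1) * map π F *
          (0 : Fin (n - s * r) → (R ⧸ stageIdeal n r F G Gi s)⟦X⟧) j +
          map π G ^ (s + 1) * X ^ (j + 1 : ℕ)) = C 1 * X ^ (j + 1 : ℕ) := by
      intro j
      simp only [Pi.zero_apply, mul_zero, zero_add, map_one, one_mul]
      linear_combination X ^ (j + 1 : ℕ) * hgπ
    simp only [hj] at hdet
    rw [hdet, det_coeff_C_mul_X_pow, one_pow]
    exact isUnit_one

/-- The last critical extension. -/
theorem CoordPair.minorExt_stageIdeal_last (h : CoordPair n r d F G) (hGi : G * Gi = 1)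
    {Fi : R⟦X⟧} (hFi : F * Fi = 1) (hr : 0 < r) {s t : ℕ} (hn : n = s * r + t) (ht : t ≤ r)
    (hunit : IsUnit ((s : R) + 1)) :
    minorExt d (n + r - t + 1) (stageIdeal n r F G Gi s) = stageIdeal n r F G Gi s ⊔
        Ideal.span {x | ∃ i, i < t ∧ x = coeff (r - i) (G ^ (s + 1) * Fi)} ∧
      minorExt d (n + r - t) (stageIdeal n r F G Gi s) = ⊤ := by
  have hN : n + r - t = s * r + r := by omega
  have hnt : n - s * r = t := by omega
  rw [hN]
  have hgG : ∀ k, G ^ k * Gi ^ k = 1 := fun k => by rw [← mul_pow, hGi, one_pow]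
  have hsurj : Function.Surjective (Ideal.Quotient.mk (stageIdeal n r F G Gi s)) :=
    Ideal.Quotient.mk_surjective
  have hker : stageIdeal n r F G Gi s =
      RingHom.ker (Ideal.Quotient.mk (stageIdeal n r F G Gi s)) := Ideal.mk_ker.symm
  obtain ⟨hH, he⟩ := stageIdeal_kills hker.le
  have key := fun N Y Z =>
    h.exists_mem_minorExt (N := N) hGi hr hsurj (by omega) hker Fi Y Z
  generalize hπ : Ideal.Quotient.mk (stageIdeal n r F G Gi s) = π at *
  have hfπ : map π F * map π Fi = 1 := by rw [← map_mul, hFi, map_one]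
  refine ⟨le_antisymm ?_ (sup_le le_sup_left (Ideal.span_le.mpr ?_)), ?_⟩
  · let K := stageIdeal n r F G Gi s ⊔
        Ideal.span {x | ∃ i, i < t ∧ x = coeff (r - i) (G ^ (s + 1) * Fi)}
    have hker' := Ideal.mk_ker (I := K)
    have hJ : stageIdeal n r F G Gi s ≤ RingHom.ker (Ideal.Quotient.mk K) :=
      le_sup_left.trans hker'.ge
    have := h.minorExt_stageIdeal_le hGi hr (s := s) (by omega) hJ (A := Fi) (E := F) (by rw [mul_comm, hFi]) (N := r) le_rfl
      (by omega) ?_ ?_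
    · rwa [hker'] at this
    · rw [hFi, map_one]
      exact degLE_one _
    · rw [hnt]
      have hQ := h.degLE_quot hGi hr _ s (by omega) (stageIdeal_kills hJ).2
      rw [hnt] at hQ
      -- The product of G^(s+1)/F and F/G^s is G, of degree at most r, and F/G^s now has degree at
      -- most t. So t vanishing coefficients suffice.
      refine degLE_of_mul ht (G := map (Ideal.Quotient.mk K) (F * Gi ^ s)) ?_ hQ ?_ ?_
      · rw [constantCoeff_map_series, map_mul, map_pow, h.constF,
          constantCoeff_of_mul_eq_one h.constG hGi]
        simp
      · rw [← map_mul]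
        have : G ^ (s + 1) * Fi * (F * Gi ^ s) = G := by
          linear_combination G ^ (s + 1) * Gi ^ s * hFi + G * hgG s
        rw [this]
        exact h.degG.map _
      · intro l hl hl'
        rw [coeff_map, Ideal.Quotient.eq_zero_iff_mem]
        refine Ideal.mem_sup_right (Ideal.subset_span ⟨r - l, by omega, ?_⟩)
        rw [Nat.sub_sub_self hl']
  · rintro _ ⟨i, hi, rfl⟩
    -- Now Y moves and Z compensates. The factor s+1 put into Y matches the one that multiplies Z,
    -- so that the truncation cancels.
    let V := map π (G ^ (s + 1) * Fi) * X ^ (i + 1)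
    obtain ⟨x, hx, hdet⟩ := key (r + 1)
      (Fin.snoc (fun j => 0)
        (((s : (R ⧸ stageIdeal n r F G Gi s)⟦X⟧) + 1) * X ^ (i + 1)))
      (Fin.snoc (fun j => X ^ (j + 1 : ℕ)) (-truncSeries r V))
      (by
        intro j
        induction j using Fin.lastCases with
        | last => simp
        | cast j => simp)
      (by
        intro j
        induction j using Fin.lastCases with
        | last =>
          have := (degLE_natCast (R := R ⧸ stageIdeal n r F G Gi s) 0 (s + 1)).mul
            (degLE_X_pow (i + 1))
          rw [Fin.snoc_last]
          push_cast at this ⊢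
          exact this.mono (by clear key; omega)
        | cast j => simpa using degLE_zero _)
      (by
        intro j
        induction j using Fin.lastCases with
        | last =>
          rw [Fin.snoc_last, map_neg, constantCoeff_trunc]
          simp [V]
        | cast j => simp)
      (by
        intro j
        induction j using Fin.lastCases with
        | last => simpa using (degLE_truncSeries _ V).neg
        | cast j => simpa using (degLE_X_pow _).mono (by omega))
    have hlast : map π Fi * (((s : (R ⧸ stageIdeal n r F G Gi s)⟦X⟧) + 1) * map π F *
          -truncSeries r V + map π G ^ (s + 1) *
          (((s : (R ⧸ stageIdeal n r F G Gi s)⟦X⟧) + 1) * X ^ (i + 1))) =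
        C (π (s + 1)) * (V - truncSeries r V) := by
      generalize truncSeries r V = W
      simp only [V, map_add, map_mul, map_pow, map_natCast, map_one]
      linear_combination -((s : (R ⧸ stageIdeal n r F G Gi s)⟦X⟧) + 1) *
        W * hfπ
    rw [det_coeff_snoc (π (s + 1))] at hdet
    · simp only [Fin.snoc_last] at hdet
      rw [hlast, coeff_C_mul, coeff_sub_trunc, if_neg (by omega)] at hdet
      rw [← add_assoc] at hx
      refine mem_minorExt_of_isUnit_mul hsurj hker hx
        (((hunit.map π).pow r).mul (hunit.map π)) ?_
      rw [hdet]
      rw [coeff_mul_X_pow', if_pos (by omega), coeff_map,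
        show r + 1 - (i + 1) = r - i by omega]
      ring
    · intro j
      simp only [Fin.snoc_castSucc, mul_zero, add_zero, map_add, map_natCast, map_one]
      linear_combination ((s : (R ⧸ stageIdeal n r F G Gi s)⟦X⟧) + 1) *
        X ^ (j + 1 : ℕ) * hfπ
    · intro l hl
      simp only [Fin.snoc_last]
      rw [hlast, coeff_C_mul, coeff_sub_trunc, if_pos (by omega), mul_zero]
  · obtain ⟨x, hx, hdet⟩ := key r 0 (fun j => X ^ (j + 1 : ℕ)) (by simp)
      (fun j => degLE_zero _) (by simp) (fun j => (degLE_X_pow _).mono (by omega))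
    refine minorExt_eq_top_of_isUnit hsurj hker hx ?_
    have hj : ∀ j : Fin r, map π Fi *
        (((s : (R ⧸ stageIdeal n r F G Gi s)⟦X⟧) + 1) * map π F * X ^ (j + 1 : ℕ) +
          map π G ^ (s + 1) * (0 : Fin r → (R ⧸ stageIdeal n r F G Gi s)⟦X⟧) j) =
        C (π (s + 1)) * X ^ (j + 1 : ℕ) := by
      intro j
      simp only [Pi.zero_apply, mul_zero, add_zero, map_add, map_natCast, map_one]
      linear_combination ((s : (R ⧸ stageIdeal n r F G Gi s)⟦X⟧) + 1) *
        X ^ (j + 1 : ℕ) * hfπ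
    simp only [hj] at hdet
    rw [hdet, det_coeff_C_mul_X_pow]
    exact (hunit.map π).pow r

end stages

/-! ### Toeplitz matrices and power series -/

section toeplitz
variable {R : Type} [CommRing R]

/-- The lower Toeplitz matrix of a power series. -/
def toeplitzHom (N : ℕ) : R⟦X⟧ →+* Matrix (Fin N) (Fin N) R where
  toFun A := Matrix.of fun i j => if j ≤ i then coeff (i - j : ℕ) A else 0
  map_one' := by
    ext i j
    rw [Matrix.of_apply, Matrix.one_apply]
    by_cases h : i = j
    · simp [h]
    · rw [if_neg h]
      split_ifs with hji
      · have : (j : ℕ) ≤ i := hji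
        have : (i : ℕ) ≠ j := fun h' => h (Fin.ext h')
        rw [coeff_one, if_neg (by omega)]
      · rfl
  map_zero' := by ext i j; simp
  map_add' A B := by
    ext i j
    simp only [Matrix.of_apply, Matrix.add_apply, map_add]
    split_ifs <;> simp
  map_mul' A B := by
    ext i j
    rw [Matrix.mul_apply]
    simp only [Matrix.of_apply]
    let f : ℕ → R := fun l => (if l ≤ i then coeff (i - l : ℕ) A else 0) *
      (if (j : ℕ) ≤ l then coeff (l - j : ℕ) B else 0)
    have hf : ∑ l : Fin N, (if l ≤ i then coeff (i - l : ℕ) A else 0) *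
        (if j ≤ l then coeff (l - j : ℕ) B else 0) = ∑ l ∈ Finset.range N, f l :=
      Fin.sum_univ_eq_sum_range f N
    rw [hf]
    have hsub : ∑ l ∈ Finset.range N, f l = ∑ l ∈ Finset.Ico (j : ℕ) (i + 1), f l := by
      symm
      refine Finset.sum_subset ?_ ?_
      · intro l hl
        have := Finset.mem_Ico.mp hl
        exact Finset.mem_range.mpr (by omega)
      · intro l _ hl
        rw [Finset.mem_Ico] at hl
        by_cases h1 : l ≤ i
        · simp only [f]
          rw [if_neg (c := (j : ℕ) ≤ l) (by omega), mul_zero]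
        · simp only [f]
          rw [if_neg h1, zero_mul]
    rw [hsub, Finset.sum_Ico_eq_sum_range]
    split_ifs with hji
    · have hji' : (j : ℕ) ≤ i := hji
      rw [mul_comm A B, coeff_mul,
        Finset.Nat.sum_antidiagonal_eq_sum_range_succ (fun p q => coeff p B * coeff q A)]
      rw [show (i : ℕ) + 1 - j = i - j + 1 by omega]
      refine Finset.sum_congr rfl fun t ht => ?_
      have := Finset.mem_range.mp ht
      simp only [f]
      rw [if_pos (by omega), if_pos (by omega), mul_comm, Nat.add_sub_cancel_left, Nat.sub_sub]
    · have : ¬ (j : ℕ) ≤ i := hji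
      rw [show (i : ℕ) + 1 - j = 0 by omega, Finset.sum_range_zero]

theorem toeplitzHom_apply (N : ℕ) (A : R⟦X⟧) (i j : Fin N) :
    toeplitzHom N A i j = if j ≤ i then coeff (i - j : ℕ) A else 0 := rfl

theorem toeplitzHom_X (N : ℕ) : toeplitzHom N (X : R⟦X⟧) = lowerShift R N := by
  ext i j
  rw [toeplitzHom_apply, lowerShift, Matrix.of_apply, coeff_X]
  by_cases h : j ≤ i
  · have : (j : ℕ) ≤ i := h
    rw [if_pos h]
    refine if_congr (by omega) rfl rfl
  · have : ¬ (j : ℕ) ≤ i := h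
    rw [if_neg h, if_neg (by omega)]

theorem toeplitzHom_C_mul (N : ℕ) (a : R) (A : R⟦X⟧) :
    toeplitzHom N (C a * A) = a • toeplitzHom N A := by
  ext i j
  rw [Matrix.smul_apply, toeplitzHom_apply, toeplitzHom_apply, coeff_C_mul]
  split_ifs <;> simp

/-- Degrees from `N` on are invisible, because the `N`-th power of the shift is zero. -/
theorem lowerToeplitz_eq_toeplitzHom {N m : ℕ} {v : ℕ → R} {A : R⟦X⟧}
    (h0 : constantCoeff A = 1)
    (hA : ∀ l, 1 ≤ l → l < N → coeff l A = if l ≤ m then v (m - l) else 0) :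
    lowerToeplitz N m v = toeplitzHom N A := by
  have h : lowerToeplitz N m v =
      toeplitzHom N (1 + ∑ k ∈ Finset.Icc 1 m, C (v (m - k)) * X ^ k) := by
    simp only [lowerToeplitz, map_add, map_one, map_sum, toeplitzHom_C_mul, map_pow,
      toeplitzHom_X]
  rw [h]
  ext i j
  rw [toeplitzHom_apply, toeplitzHom_apply]
  split_ifs with hji
  · rcases Nat.eq_zero_or_pos (i - j : ℕ) with h' | h'
    · rw [h', coeff_zero_eq_constantCoeff_apply, coeff_zero_eq_constantCoeff_apply, h0, map_add,
        map_sum, Finset.sum_eq_zero]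
      · simp
      · intro k hk
        have : k ≠ 0 := by have := Finset.mem_Icc.mp hk; omega
        simp [this]
    · rw [hA _ h' (by omega), map_add, coeff_one, if_neg (by omega), zero_add, map_sum]
      simp only [coeff_C_mul, coeff_X_pow, mul_ite, mul_one, mul_zero]
      rw [Finset.sum_ite_eq]
      refine if_congr ?_ rfl rfl
      rw [Finset.mem_Icc]
      omega
  · rfl

theorem toeplitzCoeff_toeplitzHom {N k : ℕ} (hk : k < N) (A : R⟦X⟧) :
    toeplitzCoeff (toeplitzHom N A) k = coeff k A := by
  rw [toeplitzCoeff, dif_pos hk, toeplitzHom_apply, if_pos (Fin.mk_le_mk.mpr (Nat.zero_le _))]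
  rfl

theorem inv_toeplitzHom {N : ℕ} {A B : R⟦X⟧} (h : A * B = 1) :
    (toeplitzHom N A)⁻¹ = toeplitzHom N B :=
  Matrix.inv_eq_right_inv (by rw [← map_mul, h, map_one])

end toeplitz

/-! ### The reversed generic polynomials as power series -/

/-- `1 + a_{n-1} X + ⋯ + a_0 X^n`. -/
def seriesF (n r : ℕ) : (CoeffRing n r)⟦X⟧ :=
  PowerSeries.mk fun l => if l = 0 then 1 else if l ≤ n then aVar n r (n - l) else 0

/-- `1 + b_{r-1} X + ⋯ + b_0 X^r`. -/
def seriesG (n r : ℕ) : (CoeffRing n r)⟦X⟧ :=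
  PowerSeries.mk fun l => if l = 0 then 1 else if l ≤ r then bVar n r (r - l) else 0

theorem constantCoeff_seriesF (n r : ℕ) : constantCoeff (seriesF n r) = 1 := by
  simp [seriesF]

theorem constantCoeff_seriesG (n r : ℕ) : constantCoeff (seriesG n r) = 1 := by
  simp [seriesG]

/-- The inverse of `seriesF`. -/
def seriesFi (n r : ℕ) : (CoeffRing n r)⟦X⟧ := invOfUnit (seriesF n r) 1

/-- The inverse of `seriesG`. -/
def seriesGi (n r : ℕ) : (CoeffRing n r)⟦X⟧ := invOfUnit (seriesG n r) 1

theorem seriesF_mul_inv (n r : ℕ) : seriesF n r * seriesFi n r = 1 :=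
  mul_invOfUnit _ _ (constantCoeff_seriesF n r)

theorem seriesG_mul_inv (n r : ℕ) : seriesG n r * seriesGi n r = 1 :=
  mul_invOfUnit _ _ (constantCoeff_seriesG n r)

/-- The recursion compares coefficients in (F/G) · G = F. -/
theorem dTop_eq_coeff {n r j : ℕ} (hj : 1 ≤ j) (hjn : j ≤ n) :
    dTop n r j = coeff j (seriesF n r * seriesGi n r) := by
  induction j using Nat.strong_induction_on with
  | _ j ih =>
    have hD0 : constantCoeff (seriesF n r * seriesGi n r) = 1 := by
      rw [map_mul, constantCoeff_seriesF,
        constantCoeff_of_mul_eq_one (constantCoeff_seriesG n r) (seriesG_mul_inv n r), one_mul]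
    have hDG : seriesF n r * seriesGi n r * seriesG n r = seriesF n r := by
      linear_combination seriesF n r * seriesG_mul_inv n r
    have hF : coeff j (seriesF n r) = aVar n r (n - j) := by
      rw [seriesF, coeff_mk, if_neg (by omega), if_pos hjn]
    have hG : ∀ l, 1 ≤ l → coeff l (seriesG n r) = if l ≤ r then bVar n r (r - l) else 0 :=
      fun l hl => by rw [seriesG, coeff_mk, if_neg (by omega)]
    rw [← hDG, coeff_mul, Finset.Nat.sum_antidiagonal_eq_sum_range_succ (fun p q =>
      coeff p (seriesF n r * seriesGi n r) * coeff q (seriesG n r)), Finset.sum_range_succ,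
      Finset.range_eq_Ico, Finset.sum_eq_sum_Ico_succ_bot (by omega)] at hF
    simp only [Nat.sub_self, Nat.sub_zero, coeff_zero_eq_constantCoeff_apply, hD0,
      constantCoeff_seriesG, one_mul, mul_one, hG j hj] at hF
    rw [dTop, ← hF, Finset.sum_attach (Finset.Ioo 0 j) (fun i => dTop n r i *
      (if j - i ≤ r then bVar n r (r - (j - i)) else 0))]
    have hsum : ∑ i ∈ Finset.Ioo 0 j, dTop n r i *
        (if j - i ≤ r then bVar n r (r - (j - i)) else 0) =
        ∑ k ∈ Finset.Ico (0 + 1) j, coeff k (seriesF n r * seriesGi n r) *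
          coeff (j - k) (seriesG n r) := by
      refine Finset.sum_congr (by ext; simp; omega) fun i hi => ?_
      have := Finset.mem_Ico.mp hi
      rw [ih i (by omega) (by omega) (by omega), hG _ (by omega)]
    rw [hsum]
    ring

theorem aVar_of_le {n r i : ℕ} (h : n ≤ i) : aVar n r i = 0 := dif_neg (by omega)

theorem bVar_of_le {n r i : ℕ} (h : r ≤ i) : bVar n r i = 0 := dif_neg (by omega)

theorem coeff_X_pow_add_sum {P : Type*} [CommRing P] (n : ℕ) (v : ℕ → P)
    (hv : ∀ i, n ≤ i → v i = 0) (i : ℕ) :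
    (Polynomial.X ^ n + ∑ i ∈ Finset.range n, Polynomial.C (v i) * Polynomial.X ^ i).coeff i =
      if i = n then 1 else v i := by
  rw [Polynomial.coeff_add, Polynomial.coeff_X_pow, Polynomial.finsetSum_coeff]
  simp only [Polynomial.coeff_C_mul_X_pow]
  rw [Finset.sum_ite_eq]
  by_cases h : i = n
  · simp [h]
  · rw [if_neg h, if_neg h, zero_add]
    split_ifs with h'
    · rfl
    · exact (hv i (by simpa using h')).symm

theorem coe_reflect_monic {P : Type*} [CommRing P] (n : ℕ) (v : ℕ → P)
    (hv : ∀ i, n ≤ i → v i = 0) :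
    (Polynomial.reflect n (Polynomial.X ^ n +
      ∑ i ∈ Finset.range n, Polynomial.C (v i) * Polynomial.X ^ i) : P⟦X⟧) =
      PowerSeries.mk fun l => if l = 0 then 1 else if l ≤ n then v (n - l) else 0 := by
  ext l
  rw [Polynomial.coeff_coe, Polynomial.coeff_reflect, coeff_X_pow_add_sum n v hv, coeff_mk]
  by_cases hl : l ≤ n
  · rw [Polynomial.revAt_le hl, if_pos hl]
    exact if_congr (by omega) rfl rfl
  · rw [Polynomial.revAt_eq_self_of_lt (by omega), if_neg (by omega), if_neg (by omega),
      if_neg hl, hv l (by omega)]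

theorem natDegree_X_pow_add_sum_le {P : Type*} [CommRing P] (n : ℕ) (v : ℕ → P)
    (hv : ∀ i, n ≤ i → v i = 0) :
    (Polynomial.X ^ n +
      ∑ i ∈ Finset.range n, Polynomial.C (v i) * Polynomial.X ^ i).natDegree ≤ n := by
  rw [Polynomial.natDegree_le_iff_coeff_eq_zero]
  intro N hN
  rw [coeff_X_pow_add_sum n v hv, if_neg (by omega), hv N (by omega)]

theorem seriesF_mul_seriesG (n r : ℕ) : seriesF n r * seriesG n r =
    (Polynomial.reflect (n + r) (genericF n r * genericG n r) : (CoeffRing n r)⟦X⟧) := by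
  rw [Polynomial.reflect_mul, Polynomial.coe_mul]
  · exact (congrArg₂ _ (coe_reflect_monic n (aVar n r) fun i => aVar_of_le)
      (coe_reflect_monic r (bVar n r) fun i => bVar_of_le)).symm
  · exact natDegree_X_pow_add_sum_le n (aVar n r) fun i => aVar_of_le
  · exact natDegree_X_pow_add_sum_le r (bVar n r) fun i => bVar_of_le

theorem coeff_seriesF_mul_seriesG {n r l : ℕ} (hl : l ≤ n + r) :
    coeff l (seriesF n r * seriesG n r) = cPoly n r (n + r - l) := by
  rw [seriesF_mul_seriesG, Polynomial.coeff_coe, Polynomial.coeff_reflect,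
    Polynomial.revAt_le hl, cPoly]

/-! ### The polynomials `β` and `ψ` -/

/-- B comes from G and D̂ from F/G, so D̂ accounts for the extra power of 1/G. -/
theorem matBD_eq (n r q : ℕ) :
    matBD n r q = toeplitzHom n (seriesF n r * seriesGi n r ^ (q + 1)) := by
  have hB : matB n r = toeplitzHom n (seriesG n r) :=
    lowerToeplitz_eq_toeplitzHom (constantCoeff_seriesG n r) fun l hl _ => by
      rw [seriesG, coeff_mk, if_neg (by omega)]
  have hD : matDhat n r = toeplitzHom n (seriesF n r * seriesGi n r) := by
    refine lowerToeplitz_eq_toeplitzHom ?_ fun l hl hln => ?_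
    · rw [map_mul, constantCoeff_seriesF,
        constantCoeff_of_mul_eq_one (constantCoeff_seriesG n r) (seriesG_mul_inv n r), one_mul]
    · rw [if_pos hln.le, dPoly, Nat.sub_sub_self hln.le, dTop_eq_coeff hl hln.le]
  rw [matBD, hB, hD, inv_toeplitzHom (seriesG_mul_inv n r), ← map_pow, ← map_mul]
  congr 1
  ring

theorem inv_matBD_eq (n r q : ℕ) :
    (matBD n r q)⁻¹ = toeplitzHom n (seriesG n r ^ (q + 1) * seriesFi n r) := by
  rw [matBD_eq]
  refine inv_toeplitzHom ?_
  have : seriesG n r ^ (q + 1) * seriesGi n r ^ (q + 1) = 1 := by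
    rw [← mul_pow, seriesG_mul_inv, one_pow]
  linear_combination this * seriesF n r * seriesFi n r + seriesF_mul_inv n r

theorem betaPoly_eq {n r q k : ℕ} (hk : 1 ≤ k) (hkn : k ≤ n) :
    betaPoly n r q k = coeff (n - k) (seriesG n r ^ (q + 1) * seriesFi n r) := by
  rw [betaPoly, inv_matBD_eq, toeplitzCoeff_toeplitzHom (by omega)]

theorem inv_matBD_eq_lowerToeplitz (n r q : ℕ) :
    (matBD n r q)⁻¹ = lowerToeplitz n n (betaPoly n r q) := by
  rw [inv_matBD_eq]
  refine (lowerToeplitz_eq_toeplitzHom ?_ fun l hl hln => ?_).symm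
  · rw [map_mul, map_pow, constantCoeff_seriesG,
      constantCoeff_of_mul_eq_one (constantCoeff_seriesF n r) (seriesF_mul_inv n r)]
    simp
  · rw [if_pos hln.le, betaPoly_eq (by omega) (by omega), Nat.sub_sub_self hln.le]

/-- Derivations over `ℤ` of a commutative ring. -/
abbrev IntDerivation (R : Type*) [CommRing R] := Derivation ℤ R R

/-- A derivation over `ℤ` from an additive map with the Leibniz rule. -/
def intDerivation {R : Type*} [CommRing R] (f : R → R) (hadd : ∀ a b, f (a + b) = f a + f b)
    (hmul : ∀ a b, f (a * b) = a • f b + b • f a) : IntDerivation R :=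
  Derivation.mk' (AddMonoidHom.mk' f hadd).toIntLinearMap hmul

/-- The partial derivatives of the coefficient ring. -/
def polyDeriv (n r : ℕ) (j : Fin n ⊕ Fin r) : IntDerivation (CoeffRing n r) :=
  intDerivation (MvPolynomial.pderiv j : CoeffRing n r → CoeffRing n r)
    (fun _ _ => map_add _ _ _) fun _ _ => Derivation.leibniz _ _ _

theorem polyDeriv_apply (n r : ℕ) (j : Fin n ⊕ Fin r) (p : CoeffRing n r) :
    polyDeriv n r j p = MvPolynomial.pderiv j p := rfl

theorem coordPair_poly (n r : ℕ) : CoordPair n r (polyDeriv n r) (seriesF n r) (seriesG n r) where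
  constF := constantCoeff_seriesF n r
  constG := constantCoeff_seriesG n r
  degF l hl := by rw [seriesF, coeff_mk, if_neg (by omega), if_neg (by omega)]
  degG l hl := by rw [seriesG, coeff_mk, if_neg (by omega), if_neg (by omega)]
  dFa i l := by
    rw [seriesF, coeff_mk, polyDeriv_apply, aVar]
    split_ifs with h1 h2 h3 h4 h5
    · omega
    · simp
    · have : i = ⟨n - l, h4⟩ := Fin.ext (by simp only; omega)
      rw [this, MvPolynomial.pderiv_X_self]
    · rw [MvPolynomial.pderiv_X_of_ne]
      intro h
      have := congrArg Fin.val (Sum.inl_injective h)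
      simp only at this
      omega
    all_goals first | omega | simp
  dFb j l := by
    rw [seriesF, coeff_mk, polyDeriv_apply, aVar]
    split_ifs
    · simp
    · rw [MvPolynomial.pderiv_X_of_ne (by simp)]
    all_goals simp
  dGa i l := by
    rw [seriesG, coeff_mk, polyDeriv_apply, bVar]
    split_ifs
    · simp
    · rw [MvPolynomial.pderiv_X_of_ne (by simp)]
    all_goals simp
  dGb i l := by
    rw [seriesG, coeff_mk, polyDeriv_apply, bVar]
    split_ifs with h1 h2 h3 h4 h5
    · omega
    · simp
    · have : i = ⟨r - l, h4⟩ := Fin.ext (by simp only; omega)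
      rw [this, MvPolynomial.pderiv_X_self]
    · rw [MvPolynomial.pderiv_X_of_ne]
      intro h
      have := congrArg Fin.val (Sum.inr_injective h)
      simp only at this
      omega
    all_goals first | omega | simp

/-- Only G depends on b_j, and its derivative is X^(r-j). -/
theorem derivB_coeff_quot {n r j k L : ℕ} (hj : j < r) (hL : r - j ≤ L) :
    derivB n r j (coeff L (seriesF n r * seriesGi n r ^ k)) =
      MvPolynomial.C (-(k : ℂ)) *
        coeff (L - (r - j)) (seriesF n r * seriesGi n r ^ (k + 1)) := by
  have h := coordPair_poly n r
  have hF : tangent (RingHom.id _) (polyDeriv n r (Sum.inr ⟨j, hj⟩)) (seriesF n r) = 0 := by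
    refine PowerSeries.ext fun l => ?_
    rw [coeff_tangent, h.dFb, map_zero, map_zero]
  have hG : tangent (RingHom.id _) (polyDeriv n r (Sum.inr ⟨j, hj⟩)) (seriesG n r) =
      X ^ (r - j) := by
    refine PowerSeries.ext fun l => ?_
    rw [coeff_tangent, h.dGb, coeff_X_pow]
    rfl
  have ht := congrArg (coeff L) (tangent_mul_inv_pow (RingHom.id _)
    (polyDeriv n r (Sum.inr ⟨j, hj⟩)) (F := seriesF n r) (seriesG_mul_inv n r) k)
  have hid : ∀ A : (CoeffRing n r)⟦X⟧, PowerSeries.map (RingHom.id _) A = A :=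
    fun A => PowerSeries.ext fun l => coeff_map _ _ _
  have hC : -((k : (CoeffRing n r)⟦X⟧) * seriesF n r * seriesGi n r ^ (k + 1)) =
      C (MvPolynomial.C (-(k : ℂ))) * (seriesF n r * seriesGi n r ^ (k + 1)) := by
    simp only [map_neg, map_natCast]
    ring
  rw [coeff_tangent, hF, hG, hid, hid, mul_zero, zero_sub, ← neg_mul, coeff_mul_X_pow',
    if_pos hL, hC, coeff_C_mul] at ht
  rw [derivB, dif_pos hj]
  exact ht

theorem derivB_C_mul (n r j : ℕ) (c : ℂ) (p : CoeffRing n r) :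
    derivB n r j (MvPolynomial.C c * p) = MvPolynomial.C c * derivB n r j p := by
  rw [derivB, derivB]
  split_ifs
  · rw [MvPolynomial.pderiv_C_mul, MvPolynomial.C_mul']
  · rw [mul_zero]

theorem iterate_derivB_coeff_quot {n r k L p : ℕ} (hr : 0 < r) (hL : p * r ≤ L) :
    ∃ c : ℂ, c ≠ 0 ∧
      (derivB n r 0)^[p] (coeff L (seriesF n r * seriesGi n r ^ (k + 1))) =
        MvPolynomial.C c * coeff (L - p * r) (seriesF n r * seriesGi n r ^ (k + 1 + p)) := by
  induction p with
  | zero => exact ⟨1, one_ne_zero, by simp⟩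
  | succ p ih =>
    rw [Nat.succ_mul] at hL ⊢
    obtain ⟨c, hc, h⟩ := ih (by omega)
    refine ⟨c * -((k + 1 + p : ℕ) : ℂ),
      mul_ne_zero hc (neg_ne_zero.mpr (Nat.cast_ne_zero.mpr (by omega))), ?_⟩
    rw [Function.iterate_succ_apply', h, derivB_C_mul, derivB_coeff_quot hr (by omega),
      Nat.sub_zero, ← mul_assoc, ← map_mul, Nat.sub_sub]
    rfl

/-- For k = (p+1)r + i, differentiating by b_{r-1-i} lowers the degree by i+1 and each of the p
derivatives by b_0 lowers it by r. This leads from X^(n-r+1) in F/G to X^(n-k) in F/G^(p+2). -/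
theorem psiPoly_eq_quotCoeff {n r q r₁ k : ℕ} (hn : n = q * r + r₁) (hr₁ : 0 < r₁)
    (hr : 0 < r) (hk : k < q * r) : ∃ c : ℂ, c ≠ 0 ∧
      psiPoly n r q r₁ k = MvPolynomial.C c * quotCoeff n r (seriesF n r) (seriesGi n r) k := by
  by_cases hkr : k < r
  · refine ⟨1, one_ne_zero, ?_⟩
    rw [psiPoly, if_pos hkr, dPoly, dTop_eq_coeff (by omega) (by omega), quotCoeff,
      Nat.div_eq_of_lt hkr]
    simp
  · have hdiv : 1 ≤ k / r := Nat.div_pos (by omega) hr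
    have hmod : k % r < r := Nat.mod_lt _ hr
    have hdm : r * (k / r) + k % r = k := Nat.div_add_mod k r
    obtain ⟨p, hp⟩ : ∃ p, k / r = p + 1 := ⟨k / r - 1, by omega⟩
    have hpr : r * (p + 1) = p * r + r := by ring
    rw [hp, hpr] at hdm
    rw [psiPoly, if_neg hkr, if_pos hk, dPoly, dTop_eq_coeff (by omega) (by omega), quotCoeff, hp,
      Nat.add_sub_cancel]
    have h1 := derivB_coeff_quot (n := n) (k := 1) (L := n - (r - 1)) (j := r - 1 - k % r)
      (r := r) (by omega) (by omega)
    rw [pow_one] at h1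
    obtain ⟨c, hc, h2⟩ := iterate_derivB_coeff_quot (n := n) (k := 1) (p := p)
      (L := n - (r - 1) - (r - (r - 1 - k % r))) hr (by omega)
    have hC : ∀ (c : ℂ) (x : CoeffRing n r),
        (derivB n r 0)^[p] (MvPolynomial.C c * x) = MvPolynomial.C c * (derivB n r 0)^[p] x := by
      intro c x
      exact Function.Semiconj.iterate_right (f := fun x => MvPolynomial.C c * x)
        (fun y => (derivB_C_mul n r 0 c y).symm) p x |>.symm
    refine ⟨-((1 : ℕ) : ℂ) * c, mul_ne_zero (by simp) hc, ?_⟩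
    rw [h1, hC, h2, ← mul_assoc, ← map_mul, show 1 + 1 + p = p + 1 + 1 by omega,
      show n - (r - 1) - (r - (r - 1 - k % r)) - p * r = n - k by omega]

/-- The index matches because n - ((q-1)r + r₁ + i) = r - i. -/
theorem psiPoly_eq_beta {n r q r₁ i : ℕ} (hn : n = q * r + r₁) (hq : 1 ≤ q) (hr₁ : r₁ < r)
    (hi : i < r₁) : psiPoly n r q r₁ (q * r + i) =
      coeff (r - i) (seriesG n r ^ (q + 1) * seriesFi n r) := by
  obtain ⟨p, rfl⟩ : ∃ p, q = p + 1 := ⟨q - 1, by omega⟩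
  rw [Nat.succ_mul] at hn
  rw [psiPoly, Nat.succ_mul, if_neg (by omega), if_neg (by omega), Nat.add_sub_cancel,
    Nat.add_sub_cancel_left, betaPoly_eq (by omega) (by omega)]
  congr 2
  omega

/-! ### The ring of holomorphic germs -/

section germs
variable {σ : Type} [Fintype σ]

theorem HolGerm.exists_rep (φ : HolGerm σ) : ∃ (f : (σ → ℂ) → ℂ) (hf : AnalyticAt ℂ f 0),
    φ = ⟨(f : Germ (𝓝 (0 : σ → ℂ)) ℂ), f, hf, rfl⟩ := by
  obtain ⟨_, f, hf, rfl⟩ := φ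
  exact ⟨f, hf, rfl⟩

/-- `polyGerm` as a ring homomorphism. -/
def polyGermHom (σ : Type) [Fintype σ] : MvPolynomial σ ℂ →+* HolGerm σ where
  toFun := polyGerm
  map_one' := Subtype.ext (congrArg ((↑) : ((σ → ℂ) → ℂ) → Germ (𝓝 (0 : σ → ℂ)) ℂ)
    (funext fun x => map_one (MvPolynomial.eval x)))
  map_zero' := Subtype.ext (congrArg ((↑) : ((σ → ℂ) → ℂ) → Germ (𝓝 (0 : σ → ℂ)) ℂ)
    (funext fun x => map_zero (MvPolynomial.eval x)))
  map_add' p q := Subtype.ext (congrArg ((↑) : ((σ → ℂ) → ℂ) → Germ (𝓝 (0 : σ → ℂ)) ℂ)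
    (funext fun x => map_add (MvPolynomial.eval x) p q))
  map_mul' p q := Subtype.ext (congrArg ((↑) : ((σ → ℂ) → ℂ) → Germ (𝓝 (0 : σ → ℂ)) ℂ)
    (funext fun x => map_mul (MvPolynomial.eval x) p q))

theorem polyGermHom_apply (p : MvPolynomial σ ℂ) : polyGermHom σ p = polyGerm p := rfl

/-- The value of a germ at the origin. -/
def HolGerm.valueHom (σ : Type) [Fintype σ] : HolGerm σ →+* ℂ :=
  Filter.Germ.valueRingHom.comp (HolGerm σ).subtype

theorem HolGerm.valueHom_polyGerm (p : MvPolynomial σ ℂ) :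
    HolGerm.valueHom σ (polyGermHom σ p) = MvPolynomial.eval 0 p := rfl

variable [DecidableEq σ]

/-- `HolGerm.partialDeriv` as a derivation. -/
def HolGerm.deriv (j : σ) : IntDerivation (HolGerm σ) :=
  intDerivation (HolGerm.partialDeriv j)
    (by
      intro φ ψ
      obtain ⟨f, hf, rfl⟩ := HolGerm.exists_rep φ
      obtain ⟨g, hg, rfl⟩ := HolGerm.exists_rep ψ
      refine Subtype.ext (Germ.coe_eq.mpr ?_)
      filter_upwards [hf.eventually_analyticAt, hg.eventually_analyticAt] with x hfx hgx
      exact congrArg (fun L => L (Pi.single j 1))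
        (fderiv_add hfx.differentiableAt hgx.differentiableAt))
    (by
      intro φ ψ
      obtain ⟨f, hf, rfl⟩ := HolGerm.exists_rep φ
      obtain ⟨g, hg, rfl⟩ := HolGerm.exists_rep ψ
      refine Subtype.ext (Germ.coe_eq.mpr ?_)
      filter_upwards [hf.eventually_analyticAt, hg.eventually_analyticAt] with x hfx hgx
      exact congrArg (fun L => L (Pi.single j 1))
        (fderiv_mul hfx.differentiableAt hgx.differentiableAt))

theorem HolGerm.deriv_polyGerm (j : σ) (p : MvPolynomial σ ℂ) :
    HolGerm.deriv j (polyGermHom σ p) = polyGermHom σ (MvPolynomial.pderiv j p) := by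
  induction p using MvPolynomial.induction_on with
  | C a =>
    rw [MvPolynomial.pderiv_C, map_zero]
    refine Subtype.ext (Germ.coe_eq.mpr (Eventually.of_forall fun x => ?_))
    have : (fun x : σ → ℂ => MvPolynomial.eval x (MvPolynomial.C a)) = fun _ => a :=
      funext fun x => MvPolynomial.eval_C a
    change fderiv ℂ (fun x : σ → ℂ => MvPolynomial.eval x (MvPolynomial.C a)) x _ = 0
    rw [this]
    simp
  | add p q hp hq => simp only [map_add, hp, hq]
  | mul_X p i hp =>
    have hX : HolGerm.deriv j (polyGermHom σ (MvPolynomial.X i)) =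
        polyGermHom σ (MvPolynomial.pderiv j (MvPolynomial.X i)) := by
      refine Subtype.ext (Germ.coe_eq.mpr (Eventually.of_forall fun x => ?_))
      have h1 : (fun x : σ → ℂ => MvPolynomial.eval x (MvPolynomial.X i)) =
          (ContinuousLinearMap.proj i : (σ → ℂ) →L[ℂ] ℂ) :=
        funext fun x => MvPolynomial.eval_X i
      change fderiv ℂ (fun x : σ → ℂ => MvPolynomial.eval x (MvPolynomial.X i)) x _ =
        MvPolynomial.eval x _
      rw [h1, ContinuousLinearMap.fderiv, ContinuousLinearMap.proj_apply,
        MvPolynomial.pderiv_X, Pi.single_comm]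
      by_cases h : i = j
      · subst h; simp
      · simp [h, Ne.symm h]
    simp only [map_mul, Derivation.leibniz, smul_eq_mul, map_add, hp, hX]

theorem jacobianExt_eq_minorExt (k : ℕ) (J : Ideal (HolGerm σ)) :
    jacobianExt k J = minorExt HolGerm.deriv k J := rfl

end germs

/-! ### The critical extensions of the multiplication map -/

section multiplication
variable (n r : ℕ)

/-- The series `1 + a_{n-1} X + ⋯ + a_0 X^n` with coefficients in the ring of germs. -/
def germF : (HolGerm (Fin n ⊕ Fin r))⟦X⟧ := map (polyGermHom _) (seriesF n r)

/-- The series `1 + b_{r-1} X + ⋯ + b_0 X^r` with coefficients in the ring of germs. -/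
def germG : (HolGerm (Fin n ⊕ Fin r))⟦X⟧ := map (polyGermHom _) (seriesG n r)

/-- The inverse of `germF`. -/
def germFi : (HolGerm (Fin n ⊕ Fin r))⟦X⟧ := map (polyGermHom _) (seriesFi n r)

/-- The inverse of `germG`. -/
def germGi : (HolGerm (Fin n ⊕ Fin r))⟦X⟧ := map (polyGermHom _) (seriesGi n r)

theorem germF_mul_inv : germF n r * germFi n r = 1 := by
  rw [germF, germFi, ← map_mul, seriesF_mul_inv, map_one]

theorem germG_mul_inv : germG n r * germGi n r = 1 := by
  rw [germG, germGi, ← map_mul, seriesG_mul_inv, map_one]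

theorem coordPair_germ : CoordPair n r HolGerm.deriv (germF n r) (germG n r) := by
  have h := coordPair_poly n r
  have hd : ∀ j (A : (CoeffRing n r)⟦X⟧) l, HolGerm.deriv j
      (coeff l (map (polyGermHom (Fin n ⊕ Fin r)) A)) =
        polyGermHom _ (polyDeriv n r j (coeff l A)) := by
    intro j A l
    rw [coeff_map, HolGerm.deriv_polyGerm]
    rfl
  exact
  { constF := by rw [germF, constantCoeff_map_series, h.constF, map_one]
    constG := by rw [germG, constantCoeff_map_series, h.constG, map_one]
    degF := h.degF.map _
    degG := h.degG.map _
    dFa := fun i l => by rw [germF, hd, h.dFa]; split_ifs <;> simp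
    dFb := fun j l => by rw [germF, hd, h.dFb, map_zero]
    dGa := fun i l => by rw [germG, hd, h.dGa, map_zero]
    dGb := fun j l => by rw [germG, hd, h.dGb]; split_ifs <;> simp }

theorem quotCoeff_germ (k : ℕ) : quotCoeff n r (germF n r) (germGi n r) k =
    polyGermHom _ (quotCoeff n r (seriesF n r) (seriesGi n r) k) := by
  rw [quotCoeff, quotCoeff, germF, germGi, ← map_pow, ← map_mul, coeff_map]

theorem valueHom_germF : PowerSeries.map (HolGerm.valueHom _) (germF n r) = 1 := by
  refine PowerSeries.ext fun l => ?_
  rw [coeff_map, germF, coeff_map, HolGerm.valueHom_polyGerm, seriesF, coeff_mk, coeff_one, aVar]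
  split_ifs <;> simp

theorem valueHom_germG : PowerSeries.map (HolGerm.valueHom _) (germG n r) = 1 := by
  refine PowerSeries.ext fun l => ?_
  rw [coeff_map, germG, coeff_map, HolGerm.valueHom_polyGerm, seriesG, coeff_mk, coeff_one, bVar]
  split_ifs <;> simp

theorem valueHom_germFi : PowerSeries.map (HolGerm.valueHom _) (germFi n r) = 1 := by
  have := congrArg (PowerSeries.map (HolGerm.valueHom _)) (germF_mul_inv n r)
  rwa [map_mul, valueHom_germF, one_mul, map_one] at this

theorem valueHom_germGi : PowerSeries.map (HolGerm.valueHom _) (germGi n r) = 1 := by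
  have := congrArg (PowerSeries.map (HolGerm.valueHom _)) (germG_mul_inv n r)
  rwa [map_mul, valueHom_germG, one_mul, map_one] at this

/-- At the origin F = G = 1, and every generator is a coefficient of positive degree, since k < sr ≤
n. -/
theorem stageIdeal_le_ker {s : ℕ} (hs : s * r ≤ n) :
    stageIdeal n r (germF n r) (germG n r) (germGi n r) s ≤
      RingHom.ker (HolGerm.valueHom (Fin n ⊕ Fin r)) := by
  refine Ideal.span_le.mpr ?_
  rintro x (⟨l, hl, rfl⟩ | ⟨k, hk, rfl⟩)
  · rw [SetLike.mem_coe, RingHom.mem_ker, ← coeff_map, map_mul, valueHom_germF, valueHom_germG,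
      one_mul, coeff_one, if_neg (by omega)]
  · rw [SetLike.mem_coe, RingHom.mem_ker, quotCoeff, ← coeff_map, map_mul, map_pow,
      valueHom_germF, valueHom_germGi, one_pow, one_mul, coeff_one, if_neg (by omega)]

theorem muIdeal_eq : muIdeal n r =
    Ideal.span {x | ∃ l, 1 ≤ l ∧ x = coeff l (germF n r * germG n r)} := by
  have hcoeff : ∀ l, coeff l (germF n r * germG n r) =
      polyGermHom _ (coeff l (seriesF n r * seriesG n r)) := fun l => by
    rw [germF, germG, ← map_mul, coeff_map]
  refine le_antisymm (Ideal.span_le.mpr ?_) (Ideal.span_le.mpr ?_)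
  · rintro _ ⟨j, hj, rfl⟩
    refine Ideal.subset_span ⟨n + r - j, by omega, ?_⟩
    rw [hcoeff, coeff_seriesF_mul_seriesG (by omega), Nat.sub_sub_self hj.le, polyGermHom_apply]
  · rintro _ ⟨l, hl, rfl⟩
    by_cases hl' : l ≤ n + r
    · refine Ideal.subset_span ⟨n + r - l, by omega, ?_⟩
      rw [hcoeff, coeff_seriesF_mul_seriesG hl', polyGermHom_apply]
    · have h := coordPair_germ n r
      rw [(h.degF.mul h.degG) l (by omega)]
      exact Ideal.zero_mem _

theorem stageIdeal_eq_sup (s : ℕ) : stageIdeal n r (germF n r) (germG n r) (germGi n r) s =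
    muIdeal n r ⊔ Ideal.span
      {x | ∃ k, k < s * r ∧ x = quotCoeff n r (germF n r) (germGi n r) k} := by
  rw [stageIdeal, stageGens, Ideal.span_union, muIdeal_eq]

/-- Characteristic zero enters here: the computed minors carry powers of s+1 that must be divided
out. -/
theorem isUnit_natCast_add_one (s : ℕ) : IsUnit ((s : HolGerm (Fin n ⊕ Fin r)) + 1) := by
  have h : IsUnit ((s : ℂ) + 1) := (Nat.cast_add_one_ne_zero s).isUnit
  have := (h.map (MvPolynomial.C (σ := Fin n ⊕ Fin r))).map (polyGermHom (Fin n ⊕ Fin r))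
  simpa using this

variable {n r}

theorem jacobianExt_stageIdeal (hr : 0 < r) {s : ℕ} (hs : (s + 1) * r ≤ n) :
    jacobianExt (n + 1) (stageIdeal n r (germF n r) (germG n r) (germGi n r) s) =
        stageIdeal n r (germF n r) (germG n r) (germGi n r) (s + 1) ∧
      jacobianExt n (stageIdeal n r (germF n r) (germG n r) (germGi n r) s) = ⊤ :=
  (coordPair_germ n r).minorExt_stageIdeal (germG_mul_inv n r) hr hs (isUnit_natCast_add_one n r s)

theorem iterate_upperJacobianExt (hr : 0 < r) {s : ℕ} (hs : s * r ≤ n) :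
    (upperJacobianExt r)^[s] (muIdeal n r) =
      stageIdeal n r (germF n r) (germG n r) (germGi n r) s := by
  induction s with
  | zero =>
    have : {x | ∃ k, k < 0 * r ∧ x = quotCoeff n r (germF n r) (germGi n r) k} = ∅ := by
      ext; simp
    rw [stageIdeal_eq_sup, this, Ideal.span_empty, sup_bot_eq]
    rfl
  | succ s ih =>
    have hs' := hs
    rw [Nat.succ_mul] at hs'
    rw [Function.iterate_succ_apply', ih (by omega), upperJacobianExt,
      ← (jacobianExt_stageIdeal hr hs).1]
    congr 1
    simp
    omega

theorem stageIdeal_eq_psi {q r₁ : ℕ} (hn : n = q * r + r₁) (hr₁ : 0 < r₁) (hr : 0 < r) :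
    stageIdeal n r (germF n r) (germG n r) (germGi n r) q =
      muIdeal n r ⊔ Ideal.span {x | ∃ k, k < q * r ∧ x = polyGerm (psiPoly n r q r₁ k)} := by
  rw [stageIdeal_eq_sup]
  congr 1
  refine le_antisymm (Ideal.span_le.mpr ?_) (Ideal.span_le.mpr ?_)
  · rintro _ ⟨k, hk, rfl⟩
    obtain ⟨c, hc, h⟩ := psiPoly_eq_quotCoeff hn hr₁ hr hk
    have h' : quotCoeff n r (germF n r) (germGi n r) k =
        polyGermHom _ (MvPolynomial.C c⁻¹) * polyGerm (psiPoly n r q r₁ k) := by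
      rw [h, ← polyGermHom_apply, ← map_mul, ← mul_assoc, ← map_mul, inv_mul_cancel₀ hc, map_one,
        one_mul, quotCoeff_germ]
    rw [h']
    exact Ideal.mul_mem_left _ _ (Ideal.subset_span ⟨k, hk, rfl⟩)
  · rintro _ ⟨k, hk, rfl⟩
    obtain ⟨c, hc, h⟩ := psiPoly_eq_quotCoeff hn hr₁ hr hk
    rw [h, ← polyGermHom_apply, map_mul, ← quotCoeff_germ]
    exact Ideal.mul_mem_left _ _ (Ideal.subset_span ⟨k, hk, rfl⟩)

theorem stageIdeal_sup_eq_psi {q r₁ : ℕ} (hn : n = q * r + r₁) (hq : 1 ≤ q) (hr₁ : 0 < r₁)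
    (hr : r₁ < r) :
    stageIdeal n r (germF n r) (germG n r) (germGi n r) q ⊔ Ideal.span
        {x | ∃ i, i < r₁ ∧ x = coeff (r - i) (germG n r ^ (q + 1) * germFi n r)} =
      muIdeal n r ⊔
        Ideal.span {φ | ∃ k, k < q * r + r₁ ∧ φ = polyGerm (psiPoly n r q r₁ k)} := by
  rw [stageIdeal_eq_psi hn hr₁ (by omega), sup_assoc, ← Ideal.span_union]
  congr 2
  have hβ : ∀ i < r₁, coeff (r - i) (germG n r ^ (q + 1) * germFi n r) =
      polyGerm (psiPoly n r q r₁ (q * r + i)) := fun i hi => by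
    rw [psiPoly_eq_beta hn hq hr hi, germG, germFi, ← map_pow, ← map_mul, coeff_map,
      polyGermHom_apply]
  ext x
  constructor
  · rintro (⟨k, hk, rfl⟩ | ⟨i, hi, rfl⟩)
    · exact ⟨k, by omega, rfl⟩
    · exact ⟨q * r + i, by omega, hβ i hi⟩
  · rintro ⟨k, hk, rfl⟩
    by_cases hkq : k < q * r
    · exact Or.inl ⟨k, hkq, rfl⟩
    · refine Or.inr ⟨k - q * r, by omega, ?_⟩
      rw [hβ _ (by omega), Nat.add_sub_cancel' (by omega)]

end multiplication
end

theorem theorem3p10 (n r q₁ r₁ : ℕ) (hq : 1 ≤ q₁) (hn : n = q₁ * r + r₁)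
    (hr₁ : 0 < r₁) (hr : r₁ < r) :
    -- the successive critical extensions of `I(μ_{n,r})` are `Δ^r` (`q₁` times), then `Δ^{r₁}`
    (∀ s < q₁, IsCriticalUpper r ((upperJacobianExt r)^[s] (muIdeal n r))) ∧
    IsCriticalUpper r₁ ((upperJacobianExt r)^[q₁] (muIdeal n r)) ∧
    -- `(B^{-q₁} D̂)⁻¹ = I_n + β_{n-1} L_n + ⋯ + β_1 L_n^{n-1}`
    (matBD n r q₁)⁻¹ = lowerToeplitz n n (betaPoly n r q₁) ∧
    -- the `(q₁+1)`-th critical extension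
    upperJacobianExt r₁ ((upperJacobianExt r)^[q₁] (muIdeal n r)) =
      muIdeal n r ⊔
        Ideal.span {φ | ∃ k, k < q₁ * r + r₁ ∧ φ = polyGerm (psiPoly n r q₁ r₁ k)} := by
  have hr0 : 0 < r := by omega
  have hcard : Fintype.card (Fin n ⊕ Fin r) = n + r := by simp
  have hne : ∀ K : Ideal (HolGerm (Fin n ⊕ Fin r)),
      K ≤ RingHom.ker (HolGerm.valueHom (Fin n ⊕ Fin r)) → K ≠ ⊤ := by
    rintro K hK rfl
    exact RingHom.ker_ne_top _ (top_le_iff.mp hK)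
  have hlast := (coordPair_germ n r).minorExt_stageIdeal_last (germG_mul_inv n r)
    (germF_mul_inv n r) hr0 hn hr.le (isUnit_natCast_add_one n r q₁)
  rw [← jacobianExt_eq_minorExt, ← jacobianExt_eq_minorExt] at hlast
  -- This order is q₁r + r + 1, one more than that of the unit minor.
  have hi : n + r + 1 - r₁ = n + r - r₁ + 1 := by omega
  refine ⟨fun s hs => ?_, ?_, inv_matBD_eq_lowerToeplitz n r q₁, ?_⟩
  · have hs' : (s + 1) * r ≤ n := (Nat.mul_le_mul_right r hs).trans (by omega)
    have hsr : s * r ≤ n := by rw [Nat.succ_mul] at hs'; omega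
    obtain ⟨h1, h2⟩ := jacobianExt_stageIdeal hr0 hs'
    rw [iterate_upperJacobianExt hr0 hsr, IsCriticalUpper, hcard,
      show n + r + 1 - r = n + 1 by omega, Nat.add_sub_cancel, h1]
    exact ⟨by omega, hne _ (stageIdeal_le_ker n r hs'), h2⟩
  · rw [iterate_upperJacobianExt hr0 (by omega), IsCriticalUpper, hcard, hi, hlast.1]
    refine ⟨by omega, hne _ (sup_le (stageIdeal_le_ker n r (by omega)) ?_), hlast.2⟩
    refine Ideal.span_le.mpr ?_
    rintro _ ⟨i, hi, rfl⟩
    rw [SetLike.mem_coe, RingHom.mem_ker, ← PowerSeries.coeff_map, map_mul, map_pow,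
      valueHom_germG, valueHom_germFi, one_pow, one_mul, PowerSeries.coeff_one,
      if_neg (by omega)]
  · rw [iterate_upperJacobianExt hr0 (by omega), upperJacobianExt, hcard, hi, hlast.1,
      stageIdeal_sup_eq_psi hn hq hr₁ hr]
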